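/- **Setting.** Let $d\in\mathbb N$, $U:\mathbb R^d\to\mathbb R$, and let $J\in\mathbb R^{d\times d}$ be skew-symmetric ($J^{T}=-J$). Put $\pi=e^{-U}$ (up to a multiplicative constant) and $\gamma=J\nabla U$. For $h>0$, $\xi\in\{-1,1\}$ and $x\in\mathbb R^d$ let $$\Phi_x^{h\xi}(y)=y+h\xi\,\gamma\Big(\frac{x+y}{2}\Big),\qquad y\in\mathbb R^d,$$ and let the mid-point proposal $Q_2^\xi(x,dy)$ be the law of the solution $y$ of $$\Phi_x^{h\xi}(y)=x-h\nabla U(x)+\sqrt{2h}\,\chi ,\tag{1}$$ where $\chi$ is a standard Gaussian vector in $\mathbb R^d$. Write $$Q_2^\xi(x,y)=\frac{1}{(4\pi h)^{d/2}}\,\big|\operatorname{Jac}\Phi_x^{h\xi}(y)\big|\,\exp\Big(-\frac{1}{4h}\big\|\Phi_x^{h\xi}(y)-(x-h\nabla U(x))\big\|^2\Big)$$ (the $\pi$ in $4\pi h$ being the number), and $$A^\xi(x,y)=1\wedge\frac{\pi(y)\,Q_2^{-\xi}(y,x)}{\pi(x)\,Q_2^{\xi}(x,y)} .$$ Write $x_\xi=(x,\xi)$.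 GMALA is the Markov chain on $\mathbb R^d\times\{-1,1\}$ with the following transition kernel $P$: from $x_\xi$, draw $y$ from $Q_2^\xi(x,dy)$; with probability $A^\xi(x,y)$ move to $y_\xi$, otherwise move to $x_{-\xi}$. Let $P^2(x_\xi,\cdot)=\int P(x_\xi,dz)\,P(z,\cdot)$ be the two-step kernel, and $V_s(x_\xi)=\exp(sU(x))$. **Proposition 2.6.** Assume that $U$ is three times differentiable and that, outside some ball centred at $0$, 1. the eigenvalues of $D^2U(x)$ lie in a fixed interval $[m,M]$ with $0<m\le M<\infty$; 2. the product $\|D^3U(x)\|\,\|\nabla U(x)\|$ is bounded. Then there are $s>0$ and $h_0>0$ such that, for all $0<h\le h_0$ and $\xi\in\{-1,1\}$: for all $x,\chi\in\mathbb R^d$ equation (1) has exactly one solution $y$, the proposal $Q_2^\xi(x,dy)$ has density $Q_2^\xi(x,y)$ with respect to Lebesgue measure, and $$\lim_{\|x\|\to+\infty}\frac{P^2V_s(x_\xi)}{V_s(x_\xi)}=0 .$$ -/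

import Mathlib

open MeasureTheory ProbabilityTheory Filter Topology
open scoped ENNReal Matrix

namespace GMALA

/-- The Euclidean space `ℝᵈ`. -/
abbrev Space (d : ℕ) : Type := EuclideanSpace ℝ (Fin d)

/-- The enlarged state space `ℝᵈ × {-1, 1}`: a position together with a direction. -/
abbrev State (d : ℕ) : Type := Space d × ℤˣ

variable {d : ℕ}

noncomputable section

/-- The Hessian `D²U(x)`, as a linear operator on `ℝᵈ`: the derivative of the gradient of `U`. -/
def hessian (U : Space d → ℝ) (x : Space d) : Space d →L[ℝ] Space d :=
  fderiv ℝ (gradient U) x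

/-- The third derivative `D³U(x)`, as the derivative of the Hessian; its operator norm is the
norm of `D³U(x)` as a trilinear form. -/
def thirdDeriv (U : Space d → ℝ) (x : Space d) : Space d →L[ℝ] Space d →L[ℝ] Space d :=
  fderiv ℝ (hessian U) x

/-- The potential `U` is three times differentiable on `ℝᵈ`, and outside some ball centred at `0`
the eigenvalues of `D²U` lie in a fixed interval `[m, M]` with `m > 0` and the product
`‖D³U‖ ‖∇U‖` is bounded. -/
structure ControlledPotential (U : Space d → ℝ) : Prop where
  differentiable_one : Differentiable ℝ U
  differentiable_two : Differentiable ℝ (gradient U)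
  differentiable_three : Differentiable ℝ (hessian U)
  eigenvalues_bounded : ∃ m M R : ℝ, 0 < m ∧ ∀ x : Space d, R < ‖x‖ → ∀ μ : ℝ,
    Module.End.HasEigenvalue (hessian U x : Space d →ₗ[ℝ] Space d) μ → m ≤ μ ∧ μ ≤ M
  third_bounded : ∃ C R : ℝ, ∀ x : Space d, R < ‖x‖ →
    ‖thirdDeriv U x‖ * ‖gradient U x‖ ≤ C

/-- A direction `ξ ∈ {-1, 1}` as a real number. -/
def sgn (ξ : ℤˣ) : ℝ := ((ξ : ℤ) : ℝ)

/-- The nonreversible drift `γ = J ∇U`. -/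
def drift (U : Space d → ℝ) (J : Matrix (Fin d) (Fin d) ℝ) (x : Space d) : Space d :=
  Matrix.toEuclideanCLM (n := Fin d) (𝕜 := ℝ) J (gradient U x)

/-- The mid-point map `Φ_x^{hξ}(y) = y + h ξ γ((x + y) / 2)`. -/
def midpointMap (U : Space d → ℝ) (J : Matrix (Fin d) (Fin d) ℝ) (h : ℝ) (ξ : ℤˣ)
    (x y : Space d) : Space d :=
  y + (h * sgn ξ) • drift U J ((1 / 2 : ℝ) • (x + y))

/-- `y` solves the mid-point equation `Φ_x^{hξ}(y) = x - h ∇U(x) + √(2h) χ`. -/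
def IsMidpointMove (U : Space d → ℝ) (J : Matrix (Fin d) (Fin d) ℝ) (h : ℝ) (ξ : ℤˣ)
    (x χ y : Space d) : Prop :=
  midpointMap U J h ξ x y = x - h • gradient U x + √(2 * h) • χ

/-- The solution `y` of the mid-point equation (an arbitrary point if there is no solution). -/
def midpointMove (U : Space d → ℝ) (J : Matrix (Fin d) (Fin d) ℝ) (h : ℝ) (ξ : ℤˣ)
    (x χ : Space d) : Space d :=
  Function.invFun (midpointMap U J h ξ x) (x - h • gradient U x + √(2 * h) • χ)

/-- The proposal kernel `Q₂^ξ(x, dy)`: the law of the solution `y` of the mid-point equation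
when `χ` is a standard Gaussian vector. -/
def proposal (U : Space d → ℝ) (J : Matrix (Fin d) (Fin d) ℝ) (h : ℝ) (ξ : ℤˣ)
    (x : Space d) : Measure (Space d) :=
  (stdGaussian (Space d)).map (midpointMove U J h ξ x)

/-- The proposal density
`(4πh)^{-d/2} |Jac Φ_x^{hξ}(y)| exp(-‖Φ_x^{hξ}(y) - (x - h ∇U(x))‖² / (4h))`. -/
def proposalDensity (U : Space d → ℝ) (J : Matrix (Fin d) (Fin d) ℝ) (h : ℝ) (ξ : ℤˣ)
    (x y : Space d) : ℝ :=
  1 / (4 * Real.pi * h) ^ ((d : ℝ) / 2) * |(fderiv ℝ (midpointMap U J h ξ x) y).det| *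
    Real.exp (-(‖midpointMap U J h ξ x y - (x - h • gradient U x)‖ ^ 2 / (4 * h)))

/-- The acceptance probability
`A^ξ(x, y) = 1 ∧ (π(y) Q₂^{-ξ}(y, x)) / (π(x) Q₂^ξ(x, y))`, where `π = e^{-U}` up to a
multiplicative constant, which cancels in the ratio. -/
def acceptProb (U : Space d → ℝ) (J : Matrix (Fin d) (Fin d) ℝ) (h : ℝ) (ξ : ℤˣ)
    (x y : Space d) : ℝ :=
  min 1 ((Real.exp (-U y) * proposalDensity U J h (-ξ) y x) /
    (Real.exp (-U x) * proposalDensity U J h ξ x y))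

/-- The transition kernel `P` of GMALA: from `(x, ξ)` propose `y` with law `Q₂^ξ(x, dy)`; move to
`(y, ξ)` with probability `A^ξ(x, y)`, and otherwise go to `(x, -ξ)`. -/
def transition (U : Space d → ℝ) (J : Matrix (Fin d) (Fin d) ℝ) (h : ℝ) (z : State d) :
    Measure (State d) :=
  ((proposal U J h z.2 z.1).withDensity
      (fun y => ENNReal.ofReal (acceptProb U J h z.2 z.1 y))).map (fun y => (y, z.2)) +
    (1 - ∫⁻ y, ENNReal.ofReal (acceptProb U J h z.2 z.1 y) ∂(proposal U J h z.2 z.1)) •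
      Measure.dirac (z.1, -z.2)

/-- The function `P²f`, that is `P²f(z) = ∫ P(z, dw) ∫ P(w, dv) f(v)`, for `f` with values in
`[0, ∞]`. -/
def twoStep (U : Space d → ℝ) (J : Matrix (Fin d) (Fin d) ℝ) (h : ℝ) (f : State d → ℝ≥0∞)
    (z : State d) : ℝ≥0∞ :=
  ∫⁻ w, (∫⁻ v, f v ∂(transition U J h w)) ∂(transition U J h z)

/-- The function `V_s(x, ξ) = exp(s U(x))`, with values in `[0, ∞]`. -/
def lyapunov (U : Space d → ℝ) (s : ℝ) (z : State d) : ℝ≥0∞ :=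
  ENNReal.ofReal (Real.exp (s * U z.1))

end

end GMALA

/-! A single proposal already contracts `V_s` on average. As J is skew, J∇U is orthogonal to ∇U, so
for small h a midpoint step acts like gradient descent: U(y) - U(x) ≤ -h‖∇U(x)‖²/4 + 10‖χ‖²
(`potential_midpoint_step_le`). Since ‖∇U‖ → ∞, the resulting factor e(x) (`contractionFactor`)
tends to 0 once exp(10s‖χ‖²) is integrable. The obstacle is rejection, which leaves U unchanged.
Over two steps, every path with an accepted move contributes O(e(x)); the remainder is a double
rejection, whose probability is the product of the rejection probabilities at x in the directions ξ
and -ξ (`twoStep_lyapunov_le`). It is therefore enough that one of the two directions is accepted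
with probability tending to 1.

In the acceptance ratio the Jacobians cancel (`det_one_add_skew_comp`). With g = ∇U(x) and H =
D²U(x), the logarithm of the ratio is (h²/2)(⟨g,Hg⟩ + ξ⟨g,HJg⟩) + O(h³‖g‖²) as long as ‖√(2h)χ‖ ≤
h²‖g‖. Far out the first term is at least (h²/2)m‖g‖², and the second is nonnegative for at least
one sign, so for small h that direction is accepted surely (`log_accept_ratio_nonneg`). The error
order comes from the bound on ‖D³U‖‖∇U‖: on a ball of radius O(h‖g‖) the Hessian is Lipschitz with
constant O(1/‖g‖) (`exists_hessian_lipschitz`). The excluded noise has vanishing probability because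
‖g‖ → ∞ while h is fixed. -/

namespace GMALA

/-! ### Taylor, trapezoid and descent estimates. -/

section Calculus

open scoped RealInnerProductSpace

variable {E : Type*} [NormedAddCommGroup E] [InnerProductSpace ℝ E]

/-- First order Taylor estimate for a map with Lipschitz derivative on a convex set. -/
theorem norm_taylor_le {G : E → E} {H : E → E →L[ℝ] E} (hG : ∀ x, HasFDerivAt G (H x) x)
    {s : Set E} (hs : Convex ℝ s) {Λ : ℝ} (hΛ0 : 0 ≤ Λ)
    (hΛ : ∀ p ∈ s, ∀ q ∈ s, ‖H p - H q‖ ≤ Λ * ‖p - q‖) {p q : E} (hp : p ∈ s) (hq : q ∈ s) :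
    ‖G p - G q - H q (p - q)‖ ≤ Λ * ‖p - q‖ ^ 2 := by
  have hseg : segment ℝ q p ⊆ s := hs.segment_subset hq hp
  have := Convex.norm_image_sub_le_of_norm_hasFDerivWithin_le' (f := G) (f' := H) (φ := H q)
    (C := Λ * ‖p - q‖) (s := segment ℝ q p) (x := q) (y := p)
    (fun z _ => (hG z).hasFDerivWithinAt) (fun z hz => ?_) (convex_segment q p)
    (left_mem_segment ℝ q p) (right_mem_segment ℝ q p)
  · linarith [this]
  · refine (hΛ z (hseg hz) q hq).trans ?_
    gcongr
    rw [segment_eq_image'] at hz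
    obtain ⟨t, ht, rfl⟩ := hz
    rw [add_sub_cancel_left, norm_smul, Real.norm_of_nonneg ht.1]
    exact mul_le_of_le_one_left (norm_nonneg _) ht.2

/-- Error estimate for the trapezoidal rule. -/
theorem abs_trapezoid_le [CompleteSpace E] {U : E → ℝ} {G : E → E} {H : E → E →L[ℝ] E}
    (hU : ∀ x, HasGradientAt U (G x) x)
    (hG : ∀ x, HasFDerivAt G (H x) x) (hsymm : ∀ x u v, ⟪H x u, v⟫ = ⟪u, H x v⟫)
    {s : Set E} (hs : Convex ℝ s) {Λ : ℝ} (hΛ0 : 0 ≤ Λ)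
    (hΛ : ∀ p ∈ s, ∀ q ∈ s, ‖H p - H q‖ ≤ Λ * ‖p - q‖) {p q : E} (hp : p ∈ s) (hq : q ∈ s) :
    |U p - U q - 1 / 2 * ⟪p - q, G p + G q⟫| ≤ Λ * ‖p - q‖ ^ 3 := by
  have hseg : segment ℝ q p ⊆ s := hs.segment_subset hq hp
  set f : E → ℝ := fun z => U z - U q - 1 / 2 * ⟪z - q, G z + G q⟫ with hf
  -- By symmetry of H, the gradient of the trapezoid error is half a first-order Taylor remainder of
  -- G, hence quadratically small.
  have hder : ∀ z, HasFDerivAt f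
      (innerSL ℝ ((1 / 2 : ℝ) • (G z - G q - H z (z - q)))) z := by
    intro z
    have h1 := (hU z).hasFDerivAt
    have h2 : HasFDerivAt (fun z : E => z - q) (ContinuousLinearMap.id ℝ E) z :=
      (hasFDerivAt_id z).sub_const q
    have h3 : HasFDerivAt (fun z : E => G z + G q) (H z) z := (hG z).add_const _
    have h4 := (h1.sub_const (U q)).sub ((h2.inner ℝ h3).const_mul (1 / 2 : ℝ))
    refine h4.congr_fderiv ?_
    ext v
    simp only [sub_apply, InnerProductSpace.toDual_apply_apply, smul_apply,
      ContinuousLinearMap.comp_apply, ContinuousLinearMap.prod_apply, fderivInnerCLM_apply,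
      ContinuousLinearMap.id_apply, innerSL_apply_apply, inner_smul_left, inner_sub_left, inner_add_right,
      smul_eq_mul, hsymm]
    rw [real_inner_comm (G z) v, real_inner_comm (G q) v, ← inner_sub_left]
    simp
    ring
  have key := Convex.norm_image_sub_le_of_norm_hasFDerivWithin_le (f := f)
    (C := Λ * ‖p - q‖ ^ 2) (s := segment ℝ q p) (x := q) (y := p)
    (fun z _ => (hder z).hasFDerivWithinAt) (fun z hz => ?_) (convex_segment q p)
    (left_mem_segment ℝ q p) (right_mem_segment ℝ q p)
  · have h0 : f q = 0 := by simp [hf]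
    rw [h0, sub_zero, Real.norm_eq_abs] at key
    calc _ ≤ _ := key
      _ = _ := by ring
  · rw [innerSL_apply_norm, norm_smul]
    have h1 := norm_taylor_le hG hs hΛ0 hΛ hq (hseg hz)
    have h2 : ‖G z - G q - H z (z - q)‖ = ‖G q - G z - H z (q - z)‖ := by
      rw [← norm_neg, ← neg_sub q z, map_neg]
      congr 1; abel
    have h3 : ‖q - z‖ ≤ ‖p - q‖ := by
      rw [segment_eq_image'] at hz
      obtain ⟨t, ht, rfl⟩ := hz
      rw [norm_sub_rev, add_sub_cancel_left, norm_smul, Real.norm_of_nonneg ht.1]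
      exact mul_le_of_le_one_left (norm_nonneg _) ht.2
    have h4 : ‖q - z‖ ^ 2 ≤ ‖p - q‖ ^ 2 := by gcongr
    rw [h2]
    have h5 : Λ * ‖q - z‖ ^ 2 ≤ Λ * ‖p - q‖ ^ 2 := by gcongr
    rw [Real.norm_of_nonneg (by norm_num)]
    linarith [norm_nonneg (G q - G z - H z (q - z))]

/-- Descent estimate for a function with Lipschitz gradient. -/
theorem sub_le_inner_add_sq [CompleteSpace E] {U : E → ℝ} {G : E → E}
    (hU : ∀ x, HasGradientAt U (G x) x) {L : ℝ} (hL : 0 ≤ L)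
    (hLip : ∀ x y, ‖G x - G y‖ ≤ L * ‖x - y‖) (x y : E) :
    U y - U x ≤ ⟪G x, y - x⟫ + L * ‖y - x‖ ^ 2 := by
  have := Convex.norm_image_sub_le_of_norm_hasFDerivWithin_le' (f := U)
    (f' := fun z => innerSL ℝ (G z)) (φ := innerSL ℝ (G x))
    (C := L * ‖y - x‖) (s := segment ℝ x y) (x := x) (y := y)
    (fun z _ => (hU z).hasFDerivAt.hasFDerivWithinAt) (fun z hz => ?_) (convex_segment x y)
    (left_mem_segment ℝ x y) (right_mem_segment ℝ x y)
  · rw [Real.norm_eq_abs] at this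
    have h2 := (abs_le.1 this).2
    simp only [innerSL_apply_apply] at h2
    nlinarith
  · rw [← map_sub, innerSL_apply_norm]
    refine (hLip z x).trans ?_
    gcongr
    rw [segment_eq_image'] at hz
    obtain ⟨t, ht, rfl⟩ := hz
    rw [add_sub_cancel_left, norm_smul, Real.norm_of_nonneg ht.1]
    exact mul_le_of_le_one_left (norm_nonneg _) ht.2

end Calculus

/-! ### One midpoint step: decrease of the potential and sign of the log-acceptance ratio. -/

section MidpointStep

open scoped RealInnerProductSpace

variable {E : Type*} [NormedAddCommGroup E] [InnerProductSpace ℝ E]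
  {G : E → E} {A : E →L[ℝ] E} {L h σ : ℝ} {x y w : E}

/-- The midpoint increment differs from the explicit Euler increment by a controlled error. -/
theorem norm_midpoint_sub_euler_le (hLip : ∀ x y, ‖G x - G y‖ ≤ L * ‖x - y‖)
    (hh : 0 ≤ h) (hσ : |σ| = 1)
    (hy : y + (h * σ) • A (G ((1 / 2 : ℝ) • (x + y))) = x - h • G x + w) :
    ‖y - x + h • (G x + σ • A (G x)) - w‖ ≤ h * ‖A‖ * L * ‖y - x‖ / 2 := by
  set m := (1 / 2 : ℝ) • (x + y) with hm
  have h1 : y - x + h • (G x + σ • A (G x)) - w = -((h * σ) • A (G m - G x)) := by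
    rw [map_sub]
    linear_combination (norm := module) (1 : ℝ) • hy
  have h2 : ‖m - x‖ = ‖y - x‖ / 2 := by
    have : m - x = (1 / 2 : ℝ) • (y - x) := by rw [hm]; module
    rw [this, norm_smul, Real.norm_of_nonneg (by norm_num)]; ring
  rw [h1, norm_neg, norm_smul, norm_mul, Real.norm_of_nonneg hh, Real.norm_eq_abs, hσ, mul_one]
  have h3 := A.le_opNorm (G m - G x)
  have h4 := hLip m x
  rw [h2] at h4
  calc h * ‖A (G m - G x)‖ ≤ h * (‖A‖ * (L * (‖y - x‖ / 2))) := by gcongr; exact h3.trans (by gcongr)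
    _ = _ := by ring

/-- Size of a midpoint increment. -/
theorem norm_midpoint_step_le (hLip : ∀ x y, ‖G x - G y‖ ≤ L * ‖x - y‖)
    (hh : 0 ≤ h) (hσ : |σ| = 1) (hhL : h * ‖A‖ * L ≤ 1)
    (hy : y + (h * σ) • A (G ((1 / 2 : ℝ) • (x + y))) = x - h • G x + w) :
    ‖y - x‖ ≤ 2 * (h * (‖A‖ + 1) * ‖G x‖ + ‖w‖) := by
  have h1 := norm_midpoint_sub_euler_le hLip hh hσ hy
  have h2 : ‖y - x‖ ≤ ‖y - x + h • (G x + σ • A (G x)) - w‖ + ‖h • (G x + σ • A (G x))‖ + ‖w‖ := by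
    calc ‖y - x‖ = ‖(y - x + h • (G x + σ • A (G x)) - w) - h • (G x + σ • A (G x)) + w‖ := by
          congr 1; abel
      _ ≤ _ := (norm_add_le _ _).trans (by gcongr; exact norm_sub_le _ _)
  have h3 : ‖h • (G x + σ • A (G x))‖ ≤ h * (‖A‖ + 1) * ‖G x‖ := by
    rw [norm_smul, Real.norm_of_nonneg hh, mul_assoc]
    gcongr
    refine (norm_add_le _ _).trans ?_
    rw [norm_smul, Real.norm_eq_abs, hσ, one_mul]
    linarith [A.le_opNorm (G x)]
  have h4 : h * ‖A‖ * L * ‖y - x‖ ≤ 1 * ‖y - x‖ := by gcongr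
  linarith

/-- One midpoint step decreases the potential, up to the squared size of the noise. -/
theorem potential_midpoint_step_le [CompleteSpace E] {U : E → ℝ}
    (hU : ∀ x, HasGradientAt U (G x) x) (hL : 0 ≤ L)
    (hLip : ∀ x y, ‖G x - G y‖ ≤ L * ‖x - y‖) (hA : ∀ u, ⟪u, A u⟫ = 0)
    (hh : 0 < h) (hσ : |σ| = 1) (hhL : h * ‖A‖ * L ≤ 1)
    (hh1 : h * ‖A‖ * L * (‖A‖ + 1) ≤ 1 / 4) (hh2 : 8 * L * h * (‖A‖ + 1) ^ 2 ≤ 1 / 4) {χ : E}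
    (hy : y + (h * σ) • A (G ((1 / 2 : ℝ) • (x + y))) = x - h • G x + √(2 * h) • χ) :
    U y - U x ≤ -(h * ‖G x‖ ^ 2 / 4) + 10 * ‖χ‖ ^ 2 := by
  have hA0 := norm_nonneg A
  set w := √(2 * h) • χ with hw
  have hw2 : ‖w‖ ^ 2 = 2 * h * ‖χ‖ ^ 2 := by
    rw [hw, norm_smul, mul_pow, Real.norm_of_nonneg (Real.sqrt_nonneg _),
      Real.sq_sqrt (by positivity)]
  have h1 := norm_midpoint_sub_euler_le hLip hh.le hσ hy
  have h2 := norm_midpoint_step_le hLip hh.le hσ hhL hy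
  have h3 := sub_le_inner_add_sq hU hL hLip x y
  set e := y - x + h • (G x + σ • A (G x)) - w with he
  -- Skewness removes the term `⟪G x, A (G x)⟫`, leaving pure gradient descent plus noise and error.
  have h4 : ⟪G x, y - x⟫ = -(h * ‖G x‖ ^ 2) + ⟪G x, w⟫ + ⟪G x, e⟫ := by
    rw [he]
    simp only [inner_sub_right, inner_add_right, inner_smul_right, hA, real_inner_self_eq_norm_sq]
    ring
  have h5 := real_inner_le_norm (G x) w
  have h6 : ⟪G x, e⟫ ≤ ‖G x‖ * (h * ‖A‖ * L * ‖y - x‖ / 2) :=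
    (real_inner_le_norm _ _).trans (by gcongr)
  set N := ‖G x‖
  set W := ‖w‖
  set j := ‖A‖
  have hN : 0 ≤ N := norm_nonneg _
  have hW : 0 ≤ W := norm_nonneg _
  have h7 : ‖y - x‖ ^ 2 ≤ (2 * (h * (j + 1) * N + W)) ^ 2 := by gcongr
  have h8 : N * (h * j * L * ‖y - x‖ / 2) ≤ h * N ^ 2 / 4 + N * W := by
    calc N * (h * j * L * ‖y - x‖ / 2)
        ≤ N * (h * j * L * (2 * (h * (j + 1) * N + W)) / 2) := by gcongr
      _ = (h * j * L * (j + 1)) * (h * N ^ 2) + (h * j * L) * (N * W) := by ring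
      _ ≤ 1 / 4 * (h * N ^ 2) + 1 * (N * W) := by gcongr
      _ = _ := by ring
  have h9 : L * ‖y - x‖ ^ 2 ≤ h * N ^ 2 / 4 + 8 * L * W ^ 2 := by
    calc L * ‖y - x‖ ^ 2 ≤ L * (2 * (h * (j + 1) * N + W)) ^ 2 := by gcongr
      _ ≤ L * (8 * ((h * (j + 1) * N) ^ 2 + W ^ 2)) := by
          gcongr; nlinarith [sq_nonneg (h * (j + 1) * N - W)]
      _ = (8 * L * h * (j + 1) ^ 2) * (h * N ^ 2) + 8 * L * W ^ 2 := by ring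
      _ ≤ 1 / 4 * (h * N ^ 2) + 8 * L * W ^ 2 := by gcongr
      _ = _ := by ring
  -- Young's inequality; multiplying by `h` makes the difference a perfect square, because `W ^ 2 =
  -- 2 * h * ‖χ‖ ^ 2`. The noise bound is thus independent of `h`.
  have h10 : 2 * (N * W) ≤ h * N ^ 2 / 4 + 8 * ‖χ‖ ^ 2 := by
    have : 0 ≤ h * (2 * (h * N ^ 2 / 4 + 8 * ‖χ‖ ^ 2) - 4 * (N * W)) := by
      have : h * (2 * (h * N ^ 2 / 4 + 8 * ‖χ‖ ^ 2) - 4 * (N * W)) =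
          1 / 2 * (h * N - 4 * W) ^ 2 + 8 * (2 * h * ‖χ‖ ^ 2 - W ^ 2) := by ring
      rw [this, hw2]; simp; positivity
    nlinarith [nonneg_of_mul_nonneg_right this hh]
  have h11 : 8 * L * W ^ 2 ≤ 2 * ‖χ‖ ^ 2 := by
    rw [hw2]
    have : 8 * L * h ≤ 1 / 4 := by
      refine le_trans ?_ hh2
      exact le_mul_of_one_le_right (by positivity) (by nlinarith)
    nlinarith [sq_nonneg ‖χ‖]
  linarith

/-- The constant controlling the error terms in the log-acceptance ratio. -/
noncomputable def acceptConst (j L K : ℝ) : ℝ :=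
  (2 * (L * (j * L * (2 * j + 4) / 2 + 1)) + 2 * (K * (2 * j + 4) ^ 2) +
    L ^ 2 * (2 * j + 4) ^ 2) / 4 + K * (2 * j + 4) ^ 3 +
    1 / 4 * (j * (1 + L * (2 * j + 4)) * K * (2 * j + 4) ^ 2)

set_option maxHeartbeats 1000000 in
/-- The logarithm of the acceptance ratio is nonnegative when the noise is small compared with the
gradient and the direction `σ` is favourable. -/
theorem log_accept_ratio_nonneg [CompleteSpace E] {U : E → ℝ} {H : E → E →L[ℝ] E}
    (hU : ∀ x, HasGradientAt U (G x) x) (hG : ∀ x, HasFDerivAt G (H x) x)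
    (hsymm : ∀ x u v, ⟪H x u, v⟫ = ⟪u, H x v⟫)
    (hL : 0 ≤ L) (hLip : ∀ x y, ‖G x - G y‖ ≤ L * ‖x - y‖) (hHL : ‖H x‖ ≤ L)
    (hA : ∀ u, ⟪u, A u⟫ = 0) (hh : 0 < h) (hh1 : h ≤ 1) (hσ : |σ| = 1) (hhL : h * ‖A‖ * L ≤ 1)
    {Λ K m : ℝ} (hΛ0 : 0 ≤ Λ) (hK : Λ * ‖G x‖ ≤ K)
    (hΛ : ∀ p ∈ Metric.closedBall x ((2 * ‖A‖ + 4) * h * ‖G x‖),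
      ∀ q ∈ Metric.closedBall x ((2 * ‖A‖ + 4) * h * ‖G x‖), ‖H p - H q‖ ≤ Λ * ‖p - q‖)
    (hm : m * ‖G x‖ ^ 2 ≤ ⟪G x, H x (G x)⟫) (hgood : 0 ≤ σ * ⟪G x, H x (A (G x))⟫)
    (hsmall : h * acceptConst ‖A‖ L K ≤ m / 2) (hw : ‖w‖ ≤ h ^ 2 * ‖G x‖)
    (hy : y + (h * σ) • A (G ((1 / 2 : ℝ) • (x + y))) = x - h • G x + w) :
    0 ≤ U x - U y + 1 / 2 * ⟪y - x, G x + G y⟫ +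
      h * σ / 2 * ⟪A (G ((1 / 2 : ℝ) • (x + y))), G x + G y⟫ -
      h / 4 * (‖G y‖ ^ 2 - ‖G x‖ ^ 2) := by
  have hj := norm_nonneg A
  have h1 := norm_midpoint_sub_euler_le hLip hh.le hσ hy
  have h2 := norm_midpoint_step_le hLip hh.le hσ hhL hy
  set r0 := y - x + h • (G x + σ • A (G x)) - w with hr0
  have hNn : 0 ≤ ‖G x‖ := norm_nonneg _
  -- From `h2`: 2(‖A‖ + 1) from the drift, plus 2 from the noise, as `h ^ 2 ≤ h`.
  have hδ : ‖y - x‖ ≤ (2 * ‖A‖ + 4) * h * ‖G x‖ := by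
    have : h ^ 2 * ‖G x‖ ≤ h * ‖G x‖ := by gcongr; nlinarith
    nlinarith
  set s := Metric.closedBall x ((2 * ‖A‖ + 4) * h * ‖G x‖) with hs
  have hsc : Convex ℝ s := convex_closedBall _ _
  have hxs : x ∈ s := Metric.mem_closedBall_self (by positivity)
  have hys : y ∈ s := by rw [hs, mem_closedBall_iff_norm]; exact hδ
  set z := (1 / 2 : ℝ) • (x + y) with hz
  have hzs : z ∈ s := by
    have : z = (1 / 2 : ℝ) • x + (1 / 2 : ℝ) • y := by rw [hz, smul_add]
    rw [this]; exact hsc hxs hys (by norm_num) (by norm_num) (by norm_num)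
  have hxz : ‖x - z‖ = ‖y - x‖ / 2 := by
    have : x - z = -((1 / 2 : ℝ) • (y - x)) := by rw [hz]; module
    rw [this, norm_neg, norm_smul, Real.norm_of_nonneg (by norm_num)]; ring
  have hyz : ‖y - z‖ = ‖y - x‖ / 2 := by
    have : y - z = (1 / 2 : ℝ) • (y - x) := by rw [hz]; module
    rw [this, norm_smul, Real.norm_of_nonneg (by norm_num)]; ring
  have hT1 := (abs_le.1 (abs_trapezoid_le hU hG hsymm hsc hΛ0 hΛ hys hxs)).2
  rw [add_comm (G y)] at hT1
  have hρ := norm_taylor_le hG hsc hΛ0 hΛ hys hxs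
  set ρ := G y - G x - H x (y - x) with hρd
  have hd1 := norm_taylor_le hG hsc hΛ0 hΛ hxs hzs
  have hd2 := norm_taylor_le hG hsc hΛ0 hΛ hys hzs
  rw [hxz] at hd1
  rw [hyz] at hd2
  -- Skewness allows subtracting `2 • G z` from `G x + G y`; since `z` is the midpoint, the linear
  -- terms cancel and only two Taylor remainders survive.
  have hT2 : |⟪A (G z), G x + G y⟫| ≤
      ‖A‖ * (‖G x‖ + L * ‖y - x‖) * (Λ * ‖y - x‖ ^ 2 / 2) := by
    have e1 : ⟪A (G z), G x + G y⟫ = ⟪A (G z),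
        (G x - G z - H z (x - z)) + (G y - G z - H z (y - z))⟫ := by
      have e2 : (G x - G z - H z (x - z)) + (G y - G z - H z (y - z)) =
          G x + G y - (2 : ℝ) • G z := by
        have : H z (x - z) + H z (y - z) = 0 := by
          rw [← map_add]
          have : x - z + (y - z) = 0 := by rw [hz]; module
          rw [this, map_zero]
        have e3 : H z (x - z) = - H z (y - z) := eq_neg_of_add_eq_zero_left this
        rw [e3]; module
      have e4 : ⟪A (G z), G z⟫ = 0 := by rw [real_inner_comm, hA]
      rw [e2, inner_sub_right, inner_smul_right, e4, mul_zero, sub_zero]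
    rw [e1]
    refine (abs_real_inner_le_norm _ _).trans ?_
    gcongr
    · refine (A.le_opNorm _).trans ?_
      gcongr
      have := hLip z x
      rw [norm_sub_rev z x, hxz] at this
      have h' := norm_add_le (G x) (G z - G x)
      rw [add_sub_cancel] at h'
      have : 0 ≤ L * ‖y - x‖ := by positivity
      linarith
    · refine (norm_add_le _ _).trans ?_
      nlinarith
  have hΔ := hLip y x
  -- The decisive gain: after the factor `-h / 4`, the first two terms give the h²/2 main part of
  -- the log-ratio.
  have hGy : ‖G y‖ ^ 2 - ‖G x‖ ^ 2 =
      2 * (-(h * ⟪G x, H x (G x)⟫) - h * (σ * ⟪G x, H x (A (G x))⟫) + ⟪G x, H x (r0 + w)⟫ +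
        ⟪G x, ρ⟫) + ‖G y - G x‖ ^ 2 := by
    have e1 : G y = G x + (G y - G x) := by abel
    have e2 : ‖G y‖ ^ 2 = ‖G x‖ ^ 2 + 2 * ⟪G x, G y - G x⟫ + ‖G y - G x‖ ^ 2 := by
      conv_lhs => rw [e1, norm_add_sq_real]
    have e3 : G y - G x = H x (y - x) + ρ := by rw [hρd]; abel
    have e4 : y - x = -(h • (G x + σ • A (G x))) + (r0 + w) := by rw [hr0]; abel
    have e5 : ⟪G x, G y - G x⟫ = -(h * ⟪G x, H x (G x)⟫) - h * (σ * ⟪G x, H x (A (G x))⟫) +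
        ⟪G x, H x (r0 + w)⟫ + ⟪G x, ρ⟫ := by
      rw [e3, inner_add_right]
      congr 1
      conv_lhs => rw [e4]
      simp only [map_add, map_neg, map_smul, inner_add_right, inner_neg_right, inner_smul_right]
      ring
    rw [e2, e5]; ring
  have hr : ‖r0 + w‖ ≤ (‖A‖ * L * (2 * ‖A‖ + 4) / 2 + 1) * (h ^ 2 * ‖G x‖) := by
    refine (norm_add_le _ _).trans ?_
    have : h * ‖A‖ * L * ‖y - x‖ / 2 ≤ h * ‖A‖ * L * ((2 * ‖A‖ + 4) * h * ‖G x‖) / 2 := by gcongr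
    nlinarith
  have hT3 : ⟪G x, H x (r0 + w)⟫ ≤
      L * (‖A‖ * L * (2 * ‖A‖ + 4) / 2 + 1) * (h ^ 2 * ‖G x‖ ^ 2) := by
    refine (real_inner_le_norm _ _).trans ?_
    calc ‖G x‖ * ‖H x (r0 + w)‖
        ≤ ‖G x‖ * (L * ((‖A‖ * L * (2 * ‖A‖ + 4) / 2 + 1) * (h ^ 2 * ‖G x‖))) := by
          gcongr
          exact ((H x).le_opNorm _).trans (by gcongr)
      _ = _ := by ring
  set N := ‖G x‖ with hN
  set j := ‖A‖ with hjd
  set B := 2 * j + 4 with hB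
  have hB0 : 0 ≤ B := by positivity
  have hρ2 : ⟪G x, ρ⟫ ≤ K * B ^ 2 * (h ^ 2 * N ^ 2) := by
    refine (real_inner_le_norm _ _).trans ?_
    calc N * ‖ρ‖ ≤ N * (Λ * (B * h * N) ^ 2) := by gcongr; exact hρ.trans (by gcongr)
      _ = (Λ * N) * (B ^ 2 * (h ^ 2 * N ^ 2)) := by ring
      _ ≤ K * (B ^ 2 * (h ^ 2 * N ^ 2)) := by gcongr
      _ = _ := by ring
  have hΔ2 : ‖G y - G x‖ ^ 2 ≤ L ^ 2 * B ^ 2 * (h ^ 2 * N ^ 2) := by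
    calc ‖G y - G x‖ ^ 2 ≤ (L * (B * h * N)) ^ 2 := by gcongr; exact hΔ.trans (by gcongr)
      _ = _ := by ring
  have hT1' : Λ * ‖y - x‖ ^ 3 ≤ K * B ^ 3 * (h ^ 3 * N ^ 2) := by
    calc Λ * ‖y - x‖ ^ 3 ≤ Λ * (B * h * N) ^ 3 := by gcongr
      _ = (Λ * N) * (B ^ 3 * (h ^ 3 * N ^ 2)) := by ring
      _ ≤ K * (B ^ 3 * (h ^ 3 * N ^ 2)) := by gcongr
      _ = _ := by ring
  have hT2' : j * (N + L * ‖y - x‖) * (Λ * ‖y - x‖ ^ 2 / 2) ≤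
      1 / 2 * (j * (1 + L * B) * K * B ^ 2) * (h ^ 2 * N ^ 2) := by
    calc j * (N + L * ‖y - x‖) * (Λ * ‖y - x‖ ^ 2 / 2)
        ≤ j * (N + L * (B * 1 * N)) * (Λ * (B * h * N) ^ 2 / 2) := by
          gcongr
          exact hδ.trans (by gcongr)
      _ = (Λ * N) * (1 / 2 * (j * (1 + L * B) * B ^ 2) * (h ^ 2 * N ^ 2)) := by ring
      _ ≤ K * (1 / 2 * (j * (1 + L * B) * B ^ 2) * (h ^ 2 * N ^ 2)) := by gcongr
      _ = _ := by ring
  have hT2'' : -(1 / 4 * (j * (1 + L * B) * K * B ^ 2) * (h ^ 3 * N ^ 2)) ≤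
      h * σ / 2 * ⟪A (G z), G x + G y⟫ := by
    have : |h * σ / 2 * ⟪A (G z), G x + G y⟫| ≤
        1 / 4 * (j * (1 + L * B) * K * B ^ 2) * (h ^ 3 * N ^ 2) := by
      rw [abs_mul, abs_div, abs_mul, hσ, abs_of_pos hh, abs_two]
      calc h * 1 / 2 * |⟪A (G z), G x + G y⟫|
          ≤ h * 1 / 2 * (1 / 2 * (j * (1 + L * B) * K * B ^ 2) * (h ^ 2 * N ^ 2)) := by
            gcongr; exact hT2.trans hT2'
        _ = _ := by ring
    exact (abs_le.1 this).1
  clear_value N j B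
  generalize ⟪G x, H x (G x)⟫ = a at hGy hm
  generalize σ * ⟪G x, H x (A (G x))⟫ = b at hGy hgood
  generalize ⟪G x, H x (r0 + w)⟫ = c at hGy hT3
  generalize ⟪G x, ρ⟫ = e at hGy hρ2
  generalize ‖G y - G x‖ ^ 2 = f at hGy hΔ2
  generalize ‖G y‖ ^ 2 - N ^ 2 = g at hGy ⊢
  have hGyle : h / 4 * g ≤ -(m / 2 * (h ^ 2 * N ^ 2)) +
      (2 * (L * (j * L * B / 2 + 1)) + 2 * (K * B ^ 2) + L ^ 2 * B ^ 2) / 4 *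
        (h ^ 3 * N ^ 2) := by
    have e1 : g ≤ -(2 * (h * (m * N ^ 2))) +
      (2 * (L * (j * L * B / 2 + 1)) + 2 * (K * B ^ 2) + L ^ 2 * B ^ 2) * (h ^ 2 * N ^ 2) := by
      rw [hGy]
      have e2 := mul_le_mul_of_nonneg_left hm hh.le
      have e3 := mul_nonneg hh.le hgood
      linarith
    calc _ ≤ h / 4 * _ := mul_le_mul_of_nonneg_left e1 (by positivity)
      _ = _ := by ring
  -- The three summands of `acceptConst` bound the errors from the gradient norms, the trapezoidal
  -- rule and the drift, all of order h³N²; `hsmall` absorbs them into the gain m h²N²/2.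
  have hfin := mul_le_mul_of_nonneg_right hsmall (show 0 ≤ h ^ 2 * N ^ 2 by positivity)
  unfold acceptConst at hfin
  rw [← hB] at hfin
  linarith

end MidpointStep

/-! ### Consequences of the assumptions on the potential. -/

section Potential

open scoped RealInnerProductSpace

variable {d : ℕ} {U : Space d → ℝ}

/-- Bounds on the eigenvalues of a symmetric operator bound its quadratic form and its norm. -/
theorem symmetric_bounds_of_eigenvalues {T : Space d →L[ℝ] Space d}
    (hT : ∀ u v, ⟪T u, v⟫ = ⟪u, T v⟫) {m M : ℝ} (hm : 0 < m)
    (hev : ∀ μ : ℝ, Module.End.HasEigenvalue (T : Space d →ₗ[ℝ] Space d) μ → m ≤ μ ∧ μ ≤ M) :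
    (∀ v, m * ‖v‖ ^ 2 ≤ ⟪v, T v⟫) ∧ ∀ v, ‖T v‖ ≤ M * ‖v‖ := by
  have hS : (T : Space d →ₗ[ℝ] Space d).IsSymmetric := hT
  set b := hS.eigenvectorBasis (rfl : Module.finrank ℝ (Space d) = _) with hb
  set l := hS.eigenvalues (rfl : Module.finrank ℝ (Space d) = _) with hl
  have hlb : ∀ i, m ≤ l i ∧ l i ≤ M := fun i => hev _ (hS.hasEigenvalue_eigenvalues rfl i)
  have hTb : ∀ i v, ⟪b i, T v⟫ = l i * ⟪b i, v⟫ := by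
    intro i v
    rw [← hT]
    have : T (b i) = l i • b i := hS.apply_eigenvectorBasis rfl i
    rw [this, inner_smul_left]; rfl
  refine ⟨fun v => ?_, fun v => ?_⟩
  · rw [← b.sum_inner_mul_inner v (T v), ← b.sum_sq_norm_inner_right v, Finset.mul_sum]
    refine Finset.sum_le_sum fun i _ => ?_
    rw [hTb, real_inner_comm, Real.norm_eq_abs, sq_abs]
    nlinarith [mul_le_mul_of_nonneg_right (hlb i).1 (sq_nonneg ⟪v, b i⟫)]
  -- `0 ≤ M` follows only from an existing eigenvalue; in dimension 0 both norms vanish.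
  · rcases isEmpty_or_nonempty (Fin (Module.finrank ℝ (Space d))) with he | ⟨⟨i₀⟩⟩
    · have h0 : ‖T v‖ ^ 2 = 0 := by rw [← b.sum_sq_norm_inner_right]; simp
      have h1 : ‖v‖ ^ 2 = 0 := by rw [← b.sum_sq_norm_inner_right]; simp
      rw [pow_eq_zero_iff two_ne_zero] at h0 h1
      simp [h0, h1]
    · have hM : 0 ≤ M := by linarith [hlb i₀]
      refine (sq_le_sq₀ (norm_nonneg _) (by positivity)).1 ?_
      rw [mul_pow, ← b.sum_sq_norm_inner_right, ← b.sum_sq_norm_inner_right v, Finset.mul_sum]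
      refine Finset.sum_le_sum fun i _ => ?_
      rw [hTb, norm_mul, mul_pow]
      gcongr
      rw [Real.norm_of_nonneg (by linarith [hlb i])]
      exact (hlb i).2

theorem ControlledPotential.hasGradientAt (hU : ControlledPotential U) (x : Space d) :
    HasGradientAt U (gradient U x) x :=
  (hU.differentiable_one x).hasGradientAt

theorem ControlledPotential.hasFDerivAt_gradient (hU : ControlledPotential U) (x : Space d) :
    HasFDerivAt (gradient U) (hessian U x) x :=
  (hU.differentiable_two x).hasFDerivAt

theorem ControlledPotential.inner_hessian_comm (hU : ControlledPotential U) (x u v : Space d) :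
    ⟪hessian U x u, v⟫ = ⟪u, hessian U x v⟫ := by
  have h1 : ∀ y, HasFDerivAt U (InnerProductSpace.toDual ℝ (Space d) (gradient U y)) y :=
    fun y => (hU.hasGradientAt y).hasFDerivAt
  have h2 : HasFDerivAt (fun y => (innerSL ℝ : Space d →L[ℝ] Space d →L[ℝ] ℝ) (gradient U y))
      ((innerSL ℝ : Space d →L[ℝ] Space d →L[ℝ] ℝ).comp (hessian U x)) x :=
    (innerSL ℝ).hasFDerivAt.comp x (hU.hasFDerivAt_gradient x)
  have := second_derivative_symmetric (𝕜 := ℝ)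
    (f' := fun y => (innerSL ℝ : Space d →L[ℝ] Space d →L[ℝ] ℝ) (gradient U y)) h1 h2 u v
  simp only [ContinuousLinearMap.comp_apply, innerSL_apply_apply] at this
  rw [this, real_inner_comm]

theorem ControlledPotential.continuous_hessian (hU : ControlledPotential U) :
    Continuous (hessian U) := hU.differentiable_three.continuous

theorem ControlledPotential.exists_hessian_lower (hU : ControlledPotential U) :
    ∃ m M R : ℝ, 0 < m ∧ 0 < R ∧ ∀ x, R < ‖x‖ →
      (∀ v, m * ‖v‖ ^ 2 ≤ ⟪v, hessian U x v⟫) ∧ ∀ v, ‖hessian U x v‖ ≤ M * ‖v‖ := by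
  obtain ⟨m, M, R, hm, h⟩ := hU.eigenvalues_bounded
  refine ⟨m, M, max R 1, hm, by positivity, fun x hx => ?_⟩
  exact symmetric_bounds_of_eigenvalues (hU.inner_hessian_comm x) hm
    (h x ((le_max_left _ _).trans_lt hx))

theorem ControlledPotential.exists_norm_hessian_le (hU : ControlledPotential U) :
    ∃ L : ℝ, 1 ≤ L ∧ ∀ x, ‖hessian U x‖ ≤ L := by
  obtain ⟨m, M, R, hm, hR, h⟩ := hU.exists_hessian_lower
  obtain ⟨C, hC⟩ := (isCompact_closedBall (0 : Space d) R).exists_bound_of_continuousOn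
    hU.continuous_hessian.continuousOn
  refine ⟨max 1 (max C (max M 0)), le_max_left _ _, fun x => ?_⟩
  by_cases hx : R < ‖x‖
  · refine (ContinuousLinearMap.opNorm_le_bound (hessian U x) (le_max_right M 0)
      fun v => ((h x hx).2 v).trans ?_).trans ((le_max_right _ _).trans (le_max_right _ _))
    gcongr; exact le_max_left _ _
  · exact (hC x (by simpa using hx)).trans ((le_max_left _ _).trans (le_max_right _ _))

theorem ControlledPotential.norm_gradient_sub_le (hU : ControlledPotential U) {L : ℝ}
    (hL : ∀ x, ‖hessian U x‖ ≤ L) (x y : Space d) :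
    ‖gradient U x - gradient U y‖ ≤ L * ‖x - y‖ :=
  Convex.norm_image_sub_le_of_norm_hasFDerivWithin_le (s := Set.univ)
    (fun z _ => (hU.hasFDerivAt_gradient z).hasFDerivWithinAt) (fun z _ => hL z) convex_univ
    (Set.mem_univ y) (Set.mem_univ x)

/-- Along a ray, the radial component of the gradient grows at rate at least m beyond radius R, and
its value at radius R is bounded uniformly in the direction. -/
theorem ControlledPotential.tendsto_norm_gradient (hU : ControlledPotential U) :
    Tendsto (fun x => ‖gradient U x‖) (Bornology.cobounded (Space d)) atTop := by
  obtain ⟨m, M, R, hm, hR, h⟩ := hU.exists_hessian_lower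
  obtain ⟨L, -, hL⟩ := hU.exists_norm_hessian_le
  have key : ∀ x : Space d, R < ‖x‖ →
      m * ‖x‖ - (m * R + (L * R + ‖gradient U 0‖)) ≤ ‖gradient U x‖ := by
    intro x hx
    have hx0 : ‖x‖ ≠ 0 := by linarith
    set u := ‖x‖⁻¹ • x with hu
    have hu1 : ‖u‖ = 1 := by rw [hu, norm_smul, norm_inv, norm_norm, inv_mul_cancel₀ hx0]
    have hxu : ‖x‖ • u = x := by rw [hu, smul_smul, mul_inv_cancel₀ hx0, one_smul]
    have hder : ∀ t : ℝ, HasDerivAt (fun t : ℝ => ⟪u, gradient U (t • u)⟫)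
        ⟪u, hessian U (t • u) u⟫ t := by
      intro t
      have h1 : HasDerivAt (fun t : ℝ => t • u) u t := by
        simpa using (hasDerivAt_id t).smul_const u
      have h2 := (hU.hasFDerivAt_gradient (t • u)).comp_hasDerivAt t h1
      exact (innerSL ℝ u).hasFDerivAt.comp_hasDerivAt t h2
    have hmv := (convex_Ici R).mul_sub_le_image_sub_of_le_deriv
      (f := fun t : ℝ => ⟪u, gradient U (t • u)⟫) (C := m)
      (fun t _ => (hder t).continuousAt.continuousWithinAt)
      (fun t _ => (hder t).differentiableAt.differentiableWithinAt)
      (fun t ht => ?_) R Set.self_mem_Ici ‖x‖ hx.le hx.le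
    · simp only [hxu] at hmv
      have h1 : ⟪u, gradient U x⟫ ≤ ‖gradient U x‖ := by
        simpa [hu1] using real_inner_le_norm u (gradient U x)
      have h2 : -⟪u, gradient U (R • u)⟫ ≤ ‖gradient U (R • u)‖ := by
        have := (abs_le.1 (abs_real_inner_le_norm u (gradient U (R • u)))).1
        rw [hu1, one_mul] at this; linarith
      have h3 := hU.norm_gradient_sub_le hL (R • u) 0
      rw [sub_zero, norm_smul, hu1, mul_one, Real.norm_of_nonneg hR.le] at h3
      have h4 := norm_sub_norm_le (gradient U (R • u)) (gradient U 0)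
      linarith
    · rw [interior_Ici] at ht
      have ht' : R < t := ht
      rw [(hder t).deriv]
      have := (h (t • u) (by
        rw [norm_smul, hu1, mul_one, Real.norm_of_nonneg (hR.le.trans ht'.le)]; exact ht')).1 u
      simpa [hu1] using this
  refine tendsto_atTop_mono' _ (f₁ := fun x : Space d =>
    m * ‖x‖ - (m * R + (L * R + ‖gradient U 0‖))) ?_ ?_
  · filter_upwards [tendsto_norm_cobounded_atTop.eventually (eventually_gt_atTop R)] with x hx
    exact key x hx
  · exact tendsto_atTop_add_const_right _ _
      (Tendsto.const_mul_atTop hm tendsto_norm_cobounded_atTop)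

/-- On a ball around a far away point, of radius a small multiple of the gradient, the Hessian is
Lipschitz with a constant inversely proportional to the gradient. -/
theorem ControlledPotential.exists_hessian_lipschitz (hU : ControlledPotential U) {L : ℝ}
    (hL1 : 1 ≤ L) (hL : ∀ x, ‖hessian U x‖ ≤ L) :
    ∃ K : ℝ, 0 ≤ K ∧ ∀ᶠ x in Bornology.cobounded (Space d), ∀ a : ℝ, 0 ≤ a → a * L ≤ 1 / 4 →
      ∃ Λ : ℝ, 0 ≤ Λ ∧ Λ * ‖gradient U x‖ ≤ K ∧
        ∀ p ∈ Metric.closedBall x (a * ‖gradient U x‖),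
          ∀ q ∈ Metric.closedBall x (a * ‖gradient U x‖),
            ‖hessian U p - hessian U q‖ ≤ Λ * ‖p - q‖ := by
  obtain ⟨C, R, h⟩ := hU.third_bounded
  refine ⟨2 * max C 0, by positivity, ?_⟩
  filter_upwards [hU.tendsto_norm_gradient.eventually (eventually_gt_atTop 0),
    tendsto_norm_cobounded_atTop.eventually (eventually_gt_atTop (2 * R)),
    tendsto_norm_cobounded_atTop.eventually (eventually_gt_atTop ‖gradient U 0‖)]
    with x hN hxR hx0 a ha haL
  have hN' : ‖gradient U x‖ ≤ 2 * L * ‖x‖ := by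
    have h1 := hU.norm_gradient_sub_le hL x 0
    rw [sub_zero] at h1
    have h2 := norm_sub_norm_le (gradient U x) (gradient U 0)
    nlinarith [norm_nonneg x]
  refine ⟨2 * max C 0 / ‖gradient U x‖, by positivity, (div_mul_cancel₀ _ hN.ne').le, ?_⟩
  intro p hp q hq
  refine Convex.norm_image_sub_le_of_norm_fderiv_le (𝕜 := ℝ)
    (fun z _ => hU.differentiable_three z) (fun z hz => ?_)
    (convex_closedBall x (a * ‖gradient U x‖)) hq hp
  rw [mem_closedBall_iff_norm] at hz
  -- As ‖∇U(x)‖ ≤ 2L‖x‖ and aL ≤ 1/4, the ball stays outside radius R and the gradient keeps at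
  -- least half its size there, so the bound on D³U applies with 1/‖∇U(x)‖.
  have hzx : ‖z - x‖ ≤ ‖x‖ / 2 := by
    calc ‖z - x‖ ≤ a * (2 * L * ‖x‖) := hz.trans (by gcongr)
      _ = 2 * (a * L) * ‖x‖ := by ring
      _ ≤ 2 * (1 / 4) * ‖x‖ := by gcongr
      _ = _ := by ring
  have hzR : R < ‖z‖ := by
    have := norm_sub_norm_le x z
    rw [norm_sub_rev] at this
    linarith
  have hGz : ‖gradient U x‖ / 2 ≤ ‖gradient U z‖ := by
    have h1 := hU.norm_gradient_sub_le hL x z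
    have h2 := norm_sub_norm_le (gradient U x) (gradient U z)
    rw [norm_sub_rev x z] at h1
    have h3 : L * ‖z - x‖ ≤ ‖gradient U x‖ / 4 := by
      calc L * ‖z - x‖ ≤ L * (a * ‖gradient U x‖) := by gcongr
        _ = (a * L) * ‖gradient U x‖ := by ring
        _ ≤ 1 / 4 * ‖gradient U x‖ := by gcongr
        _ = _ := by ring
    linarith
  rw [le_div_iff₀ hN]
  have h1 : ‖thirdDeriv U z‖ * ‖gradient U z‖ ≤ max C 0 := (h z hzR).trans (le_max_left _ _)
  have h2 : ‖thirdDeriv U z‖ * (‖gradient U x‖ / 2) ≤ ‖thirdDeriv U z‖ * ‖gradient U z‖ := by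
    gcongr
  have h3 : fderiv ℝ (hessian U) z = thirdDeriv U z := rfl
  rw [h3]
  linarith

end Potential

/-! ### Linear algebra of skew-symmetric times symmetric operators. -/

section Skew

open scoped RealInnerProductSpace

variable {d : ℕ} {J : Matrix (Fin d) (Fin d) ℝ}

theorem inner_toEuclideanCLM_self_of_skew (hJ : Jᵀ = -J) (u : Space d) :
    ⟪u, Matrix.toEuclideanCLM (n := Fin d) (𝕜 := ℝ) J u⟫ = 0 := by
  have h1 : ⟪u, Matrix.toEuclideanCLM (n := Fin d) (𝕜 := ℝ) J u⟫ =
      -⟪u, Matrix.toEuclideanCLM (n := Fin d) (𝕜 := ℝ) J u⟫ := by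
    conv_lhs => rw [Matrix.inner_toEuclideanCLM, Matrix.dotProduct_mulVec,
      ← Matrix.mulVec_transpose, hJ, Matrix.neg_mulVec, neg_dotProduct, dotProduct_comm,
      ← Matrix.inner_toEuclideanCLM]
  linarith

theorem det_toEuclideanCLM (M : Matrix (Fin d) (Fin d) ℝ) :
    (Matrix.toEuclideanCLM (n := Fin d) (𝕜 := ℝ) M).det = M.det := by
  rw [ContinuousLinearMap.det, Matrix.coe_toEuclideanCLM_eq_toEuclideanLin,
    Matrix.toEuclideanLin_eq_toLin_orthonormal, LinearMap.det_toLin]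

/-- For `J` skew-symmetric and `H` symmetric, `det (1 + c J H) = det (1 - c J H)`. -/
theorem det_one_add_skew_comp (hJ : Jᵀ = -J) {H : Space d →L[ℝ] Space d}
    (hH : ∀ u v, ⟪H u, v⟫ = ⟪u, H v⟫) (c : ℝ) :
    (1 + c • (Matrix.toEuclideanCLM (n := Fin d) (𝕜 := ℝ) J * H)).det =
      (1 + (-c) • (Matrix.toEuclideanCLM (n := Fin d) (𝕜 := ℝ) J * H)).det := by
  obtain ⟨M, rfl⟩ : ∃ M, Matrix.toEuclideanCLM (n := Fin d) (𝕜 := ℝ) M = H :=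
    EquivLike.surjective _ H
  have hM : Mᵀ = M := by
    have h1 : star (Matrix.toEuclideanCLM (n := Fin d) (𝕜 := ℝ) M) =
        Matrix.toEuclideanCLM (n := Fin d) (𝕜 := ℝ) M := by
      rw [ContinuousLinearMap.star_eq_adjoint]
      exact (ContinuousLinearMap.eq_adjoint_iff _ _).2 hH |>.symm
    rw [← map_star] at h1
    have := (Matrix.toEuclideanCLM (n := Fin d) (𝕜 := ℝ)).injective h1
    rwa [Matrix.star_eq_conjTranspose, Matrix.conjTranspose_eq_transpose_of_trivial] at this
  have h2 : ∀ c : ℝ, 1 + c • (Matrix.toEuclideanCLM (n := Fin d) (𝕜 := ℝ) J *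
      Matrix.toEuclideanCLM (n := Fin d) (𝕜 := ℝ) M) =
      Matrix.toEuclideanCLM (n := Fin d) (𝕜 := ℝ) (1 + c • (J * M)) := by
    intro c; simp
  rw [h2, h2, det_toEuclideanCLM, det_toEuclideanCLM, ← Matrix.det_transpose]
  -- Transposition flips the sign and the order; Sylvester's identity restores the order.
  have h3 : (1 + c • (J * M))ᵀ = 1 + M * ((-c) • J) := by
    rw [Matrix.transpose_add, Matrix.transpose_smul, Matrix.transpose_mul, hM, hJ]
    simp
  rw [h3, Matrix.det_one_add_mul_comm, smul_mul_assoc]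

theorem det_one_add_ne_zero {T : Space d →L[ℝ] Space d} (hT : ‖T‖ < 1) : (1 + T).det ≠ 0 := by
  have h1 : IsUnit (1 + T) := by
    have := isUnit_one_sub_of_norm_lt_one (x := -T) (by rwa [norm_neg])
    rwa [sub_neg_eq_add] at this
  have h2 : IsUnit ((1 + T : Space d →L[ℝ] Space d) : Space d →ₗ[ℝ] Space d) :=
    h1.map (ContinuousLinearMap.toLinearMapRingHom (R₁ := ℝ) (M₁ := Space d))
  exact (LinearMap.isUnit_iff_isUnit_det _).1 h2 |>.ne_zero

end Skew

/-! ### Density of the standard Gaussian, by characteristic functions. -/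

section Gaussian

open scoped RealInnerProductSpace

/-- The density of the standard Gaussian measure on `ℝᵈ`. -/
theorem stdGaussian_eq_withDensity (d : ℕ) :
    stdGaussian (Space d) = volume.withDensity
      (fun v => ENNReal.ofReal (1 / (2 * Real.pi) ^ ((d : ℝ) / 2) * Real.exp (-(‖v‖ ^ 2 / 2)))) := by
  have hint : Integrable (fun v : Space d =>
      1 / (2 * Real.pi) ^ ((d : ℝ) / 2) * Real.exp (-(‖v‖ ^ 2 / 2))) := by
    have := (GaussianFourier.integrable_cexp_neg_mul_sq_norm_add (V := Space d)
      (b := (1 / 2 : ℂ)) (by norm_num) 0 0).re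
    refine (this.congr (ae_of_all _ fun v => ?_)).const_mul _
    simp only [zero_mul, add_zero, RCLike.re_to_complex]
    rw [show -(1 / 2 : ℂ) * (‖v‖ : ℂ) ^ 2 = ((-(‖v‖ ^ 2 / 2) : ℝ) : ℂ) by push_cast; ring,
      Complex.exp_ofReal_re]
  have hfin := isFiniteMeasure_withDensity_ofReal hint.hasFiniteIntegral
  refine Measure.ext_of_charFun ?_
  ext t
  rw [charFun_stdGaussian, charFun_apply, integral_withDensity_eq_integral_toReal_smul₀
    hint.aestronglyMeasurable.aemeasurable.ennreal_ofReal (by simp)]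
  have hpt : ∀ v : Space d, (ENNReal.ofReal
      (1 / (2 * Real.pi) ^ ((d : ℝ) / 2) * Real.exp (-(‖v‖ ^ 2 / 2)))).toReal •
        Complex.exp (⟪v, t⟫ * Complex.I) = (1 / (2 * Real.pi) ^ ((d : ℝ) / 2) : ℝ) *
        Complex.exp (-(1 / 2 : ℂ) * ‖v‖ ^ 2 + Complex.I * ⟪t, v⟫) := by
    intro v
    rw [ENNReal.toReal_ofReal (by positivity), Complex.real_smul, Complex.ofReal_mul,
      mul_assoc, Complex.ofReal_exp, ← Complex.exp_add, real_inner_comm]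
    congr 2
    push_cast; ring
  simp_rw [hpt]
  rw [integral_const_mul, GaussianFourier.integral_cexp_neg_mul_sq_norm_add (by norm_num)]
  have h1 : ((Real.pi : ℂ) / (1 / 2)) ^ ((Module.finrank ℝ (Space d) : ℂ) / 2) =
      (((2 * Real.pi) ^ ((d : ℝ) / 2) : ℝ) : ℂ) := by
    rw [Complex.ofReal_cpow (by positivity), finrank_euclideanSpace_fin]
    push_cast
    congr 1
    ring
  have h2 : (((2 * Real.pi) ^ ((d : ℝ) / 2) : ℝ) : ℂ) ≠ 0 := by
    exact_mod_cast (Real.rpow_pos_of_pos (by positivity) _).ne'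
  rw [h1, ← mul_assoc, Complex.ofReal_div, Complex.ofReal_one, one_div, inv_mul_cancel₀ h2, one_mul,
    Complex.I_sq]
  congr 1
  ring

end Gaussian

/-! ### Solvability of the midpoint equation and density of its law. -/

section Proposal

open scoped RealInnerProductSpace

variable {d : ℕ} {U : Space d → ℝ} {J : Matrix (Fin d) (Fin d) ℝ} {h L : ℝ} {ξ : ℤˣ}

theorem abs_sgn (ξ : ℤˣ) : |sgn ξ| = 1 := by
  rcases Int.units_eq_one_or ξ with rfl | rfl <;> simp [sgn]

theorem sgn_neg (ξ : ℤˣ) : sgn (-ξ) = -sgn ξ := by simp [sgn]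

theorem midpointMap_hasFDerivAt (hU : ControlledPotential U) (x y : Space d) :
    HasFDerivAt (midpointMap U J h ξ x)
      (1 + (h * sgn ξ / 2) • (Matrix.toEuclideanCLM (n := Fin d) (𝕜 := ℝ) J *
        hessian U ((1 / 2 : ℝ) • (x + y)))) y := by
  have h1 : HasFDerivAt (fun y : Space d => (1 / 2 : ℝ) • (x + y))
      ((1 / 2 : ℝ) • ContinuousLinearMap.id ℝ (Space d)) y :=
    ((hasFDerivAt_id y).const_add x).const_smul (1 / 2 : ℝ)
  have h2 := ((Matrix.toEuclideanCLM (n := Fin d) (𝕜 := ℝ) J).hasFDerivAt.comp y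
    ((hU.hasFDerivAt_gradient _).comp y h1)).const_smul (h * sgn ξ)
  refine ((hasFDerivAt_id y).add h2).congr_fderiv ?_
  ext1 v
  simp only [add_apply, smul_apply, ContinuousLinearMap.comp_apply, ContinuousLinearMap.id_apply,
    map_smul, one_apply_eq_self, mul_apply_eq_comp, smul_smul]
  congr 2
  ring

theorem midpointMap_continuous (hU : ControlledPotential U) (x : Space d) :
    Continuous (midpointMap U J h ξ x) :=
  continuous_iff_continuousAt.2 fun y => (midpointMap_hasFDerivAt hU x y).continuousAt

/-- A solution is a fixed point of a map with Lipschitz constant h‖J‖L/2 ≤ 1/2, the half coming from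
the midpoint; Banach's theorem applies. -/
theorem midpointMap_bijective (hU : ControlledPotential U) (hL : ∀ x, ‖hessian U x‖ ≤ L)
    (hh : 0 ≤ h) (hhL : h * ‖Matrix.toEuclideanCLM (n := Fin d) (𝕜 := ℝ) J‖ * L ≤ 1)
    (x : Space d) : Function.Bijective (midpointMap U J h ξ x) := by
  rw [Function.bijective_iff_existsUnique]
  intro b
  set A := Matrix.toEuclideanCLM (n := Fin d) (𝕜 := ℝ) J with hA
  set f : Space d → Space d := fun y => b - (h * sgn ξ) • drift U J ((1 / 2 : ℝ) • (x + y)) with hf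
  have hc : ContractingWith (1 / 2) f := by
    refine ⟨by norm_num, LipschitzWith.of_dist_le_mul fun y z => ?_⟩
    have h1 : f y - f z = -((h * sgn ξ) • A (gradient U ((1 / 2 : ℝ) • (x + y)) -
        gradient U ((1 / 2 : ℝ) • (x + z)))) := by
      rw [map_sub]; simp only [hf, drift]; module
    have h2 := hU.norm_gradient_sub_le hL ((1 / 2 : ℝ) • (x + y)) ((1 / 2 : ℝ) • (x + z))
    have h3 : (1 / 2 : ℝ) • (x + y) - (1 / 2 : ℝ) • (x + z) = (1 / 2 : ℝ) • (y - z) := by module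
    rw [h3, norm_smul, Real.norm_of_nonneg (by norm_num : (0 : ℝ) ≤ 1 / 2)] at h2
    rw [dist_eq_norm, dist_eq_norm, h1, norm_neg, norm_smul, norm_mul, Real.norm_of_nonneg hh,
      Real.norm_eq_abs, abs_sgn, mul_one]
    calc h * ‖A _‖ ≤ h * (‖A‖ * (L * (1 / 2 * ‖y - z‖))) := by
          gcongr; exact (A.le_opNorm _).trans (by gcongr)
      _ = (h * ‖A‖ * L) * (1 / 2 * ‖y - z‖) := by ring
      _ ≤ 1 * (1 / 2 * ‖y - z‖) := by gcongr
      _ = _ := by simp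
  have hiff : ∀ y, midpointMap U J h ξ x y = b ↔ f y = y := by
    intro y
    simp only [midpointMap, hf]
    rw [← eq_sub_iff_add_eq, eq_comm]
  refine ⟨hc.fixedPoint f, (hiff _).2 hc.fixedPoint_isFixedPt, fun y hy => ?_⟩
  exact hc.fixedPoint_unique ((hiff y).1 hy)

theorem midpointMap_midpointMove
    (hb : Function.Bijective (midpointMap U J h ξ x)) (χ : Space d) :
    midpointMap U J h ξ x (midpointMove U J h ξ x χ) =
      x - h • gradient U x + √(2 * h) • χ :=
  Function.rightInverse_invFun hb.2 _

/-- The noise that produces a given proposal. -/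
noncomputable def noiseOf (U : Space d → ℝ) (J : Matrix (Fin d) (Fin d) ℝ) (h : ℝ) (ξ : ℤˣ)
    (x y : Space d) : Space d :=
  (√(2 * h))⁻¹ • (midpointMap U J h ξ x y - (x - h • gradient U x))

theorem noiseOf_midpointMove (hh : 0 < h) {x : Space d}
    (hb : Function.Bijective (midpointMap U J h ξ x)) (χ : Space d) :
    noiseOf U J h ξ x (midpointMove U J h ξ x χ) = χ := by
  have : √(2 * h) ≠ 0 := by positivity
  rw [noiseOf, midpointMap_midpointMove hb, add_sub_cancel_left, smul_smul, inv_mul_cancel₀ this,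
    one_smul]

theorem midpointMove_noiseOf (hh : 0 < h) {x : Space d}
    (hb : Function.Bijective (midpointMap U J h ξ x)) (y : Space d) :
    midpointMove U J h ξ x (noiseOf U J h ξ x y) = y := by
  have : √(2 * h) ≠ 0 := by positivity
  rw [midpointMove, noiseOf, smul_smul, mul_inv_cancel₀ this, one_smul, add_sub_cancel]
  exact Function.leftInverse_invFun hb.1 y

theorem noiseOf_continuous (hU : ControlledPotential U) (x : Space d) :
    Continuous (noiseOf U J h ξ x) :=
  ((midpointMap_continuous hU x).sub continuous_const).const_smul (√(2 * h))⁻¹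

/-- The inverse `noiseOf` is explicit, continuous and injective, hence a measurable embedding
(Lusin–Souslin), so no regularity of the implicit solution is needed. -/
theorem midpointMove_measurableEmbedding (hU : ControlledPotential U) (hh : 0 < h) {x : Space d}
    (hb : Function.Bijective (midpointMap U J h ξ x)) :
    MeasurableEmbedding (midpointMove U J h ξ x) := by
  have h1 : MeasurableEmbedding (noiseOf U J h ξ x) :=
    (noiseOf_continuous hU x).measurableEmbedding
      (Function.LeftInverse.injective (midpointMove_noiseOf hh hb))
  refine ⟨Function.LeftInverse.injective (noiseOf_midpointMove hh hb), fun s hs => ?_,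
    fun {s} hs => ?_⟩
  · rw [← Set.image_eq_preimage_of_inverse (midpointMove_noiseOf hh hb)
      (noiseOf_midpointMove hh hb)]
    exact h1.measurableSet_image.2 hs
  · rw [Set.image_eq_preimage_of_inverse (noiseOf_midpointMove hh hb)
      (midpointMove_noiseOf hh hb)]
    exact h1.measurable hs

/-- The proposal has the explicit density `proposalDensity`. -/
theorem proposal_eq_withDensity (hU : ControlledPotential U) (hh : 0 < h) {x : Space d}
    (hb : Function.Bijective (midpointMap U J h ξ x)) :
    proposal U J h ξ x =
      volume.withDensity (fun y => ENNReal.ofReal (proposalDensity U J h ξ x y)) := by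
  have hs0 : 0 < √(2 * h) := by positivity
  ext s hs
  have hemb := midpointMove_measurableEmbedding hU hh hb
  rw [proposal, hemb.map_apply, ← Set.image_eq_preimage_of_inverse (midpointMove_noiseOf hh hb)
      (noiseOf_midpointMove hh hb), stdGaussian_eq_withDensity, withDensity_apply _ (by
        rw [Set.image_eq_preimage_of_inverse (midpointMove_noiseOf hh hb)
          (noiseOf_midpointMove hh hb)]
        exact hemb.measurable hs), withDensity_apply _ hs]
  -- The change of variables runs through `noiseOf`, whose derivative is explicit.
  have hder : ∀ y, HasFDerivAt (noiseOf U J h ξ x)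
      ((√(2 * h))⁻¹ • fderiv ℝ (midpointMap U J h ξ x) y) y := fun y =>
    ((midpointMap_hasFDerivAt hU x y).differentiableAt.hasFDerivAt.sub_const _).const_smul (√(2 * h))⁻¹
  rw [lintegral_image_eq_lintegral_abs_det_fderiv_mul volume hs
    (fun y _ => (hder y).hasFDerivWithinAt)
    (Function.LeftInverse.injective (midpointMove_noiseOf hh hb)).injOn]
  refine lintegral_congr fun y => ?_
  rw [← ENNReal.ofReal_mul (abs_nonneg _), proposalDensity]
  congr 1
  have h1 : ((√(2 * h))⁻¹ • fderiv ℝ (midpointMap U J h ξ x) y).det =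
      ((√(2 * h))⁻¹) ^ d * (fderiv ℝ (midpointMap U J h ξ x) y).det := by
    rw [ContinuousLinearMap.det, ContinuousLinearMap.toLinearMap_smul, LinearMap.det_smul,
      finrank_euclideanSpace_fin]
  have h2 : ‖noiseOf U J h ξ x y‖ ^ 2 / 2 =
      ‖midpointMap U J h ξ x y - (x - h • gradient U x)‖ ^ 2 / (4 * h) := by
    rw [noiseOf, norm_smul, mul_pow, norm_inv, Real.norm_of_nonneg hs0.le, inv_pow,
      Real.sq_sqrt (by positivity)]
    field_simp
    ring
  have h3 : (4 * Real.pi * h) ^ ((d : ℝ) / 2) = (2 * Real.pi) ^ ((d : ℝ) / 2) * √(2 * h) ^ d := by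
    rw [show 4 * Real.pi * h = (2 * Real.pi) * (2 * h) by ring,
      Real.mul_rpow (by positivity) (by positivity)]
    congr 1
    rw [Real.sqrt_eq_rpow, ← Real.rpow_natCast, ← Real.rpow_mul (by positivity)]
    congr 1
    ring
  rw [h1, h2, h3, abs_mul, abs_of_pos (by positivity : 0 < (√(2 * h))⁻¹ ^ d), inv_pow]
  field_simp

end Proposal

/-! ### The acceptance ratio and the rejection probability. -/

section Acceptance

open scoped RealInnerProductSpace

variable {d : ℕ} {U : Space d → ℝ} {J : Matrix (Fin d) (Fin d) ℝ} {h L : ℝ} {ξ : ℤˣ}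

/-- Both Jacobians involve the Hessian at the same midpoint, with opposite signs of J. -/
theorem det_fderiv_midpointMap_swap (hJ : Jᵀ = -J) (hU : ControlledPotential U) (x y : Space d) :
    (fderiv ℝ (midpointMap U J h (-ξ) y) x).det = (fderiv ℝ (midpointMap U J h ξ x) y).det := by
  rw [(midpointMap_hasFDerivAt hU y x).fderiv, (midpointMap_hasFDerivAt hU x y).fderiv,
    add_comm y x, sgn_neg, det_one_add_skew_comp hJ (hU.inner_hessian_comm _) (h * sgn ξ / 2)]
  congr 3
  ring

theorem det_fderiv_midpointMap_ne_zero (hU : ControlledPotential U)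
    (hL : ∀ x, ‖hessian U x‖ ≤ L) (hh : 0 ≤ h)
    (hhL : h * ‖Matrix.toEuclideanCLM (n := Fin d) (𝕜 := ℝ) J‖ * L ≤ 1) (x y : Space d) :
    (fderiv ℝ (midpointMap U J h ξ x) y).det ≠ 0 := by
  rw [(midpointMap_hasFDerivAt hU x y).fderiv]
  apply det_one_add_ne_zero
  rw [norm_smul, Real.norm_eq_abs, abs_div, abs_mul, abs_sgn, abs_of_nonneg hh, abs_two, mul_one]
  calc _ ≤ h / 2 * (‖Matrix.toEuclideanCLM (n := Fin d) (𝕜 := ℝ) J‖ * L) := by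
        gcongr
        exact (norm_mul_le _ _).trans (by gcongr; exact hL _)
    _ = (h * ‖Matrix.toEuclideanCLM (n := Fin d) (𝕜 := ℝ) J‖ * L) / 2 := by ring
    _ < 1 := by linarith

/-- A proposal is accepted surely when the logarithm of the acceptance ratio is nonnegative. -/
theorem acceptProb_eq_one (hJ : Jᵀ = -J) (hU : ControlledPotential U)
    (hL : ∀ x, ‖hessian U x‖ ≤ L) (hh : 0 < h)
    (hhL : h * ‖Matrix.toEuclideanCLM (n := Fin d) (𝕜 := ℝ) J‖ * L ≤ 1) {x y : Space d}
    (hlog : 0 ≤ U x - U y + 1 / 2 * ⟪y - x, gradient U x + gradient U y⟫ +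
      h * sgn ξ / 2 * ⟪Matrix.toEuclideanCLM (n := Fin d) (𝕜 := ℝ) J
        (gradient U ((1 / 2 : ℝ) • (x + y))), gradient U x + gradient U y⟫ -
      h / 4 * (‖gradient U y‖ ^ 2 - ‖gradient U x‖ ^ 2)) :
    acceptProb U J h ξ x y = 1 := by
  have hdet := det_fderiv_midpointMap_ne_zero (ξ := ξ) hU hL hh.le hhL x y
  have hc : 0 < 1 / (4 * Real.pi * h) ^ ((d : ℝ) / 2) := by positivity
  have hd0 : 0 < |(fderiv ℝ (midpointMap U J h ξ x) y).det| := abs_pos.2 hdet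
  refine min_eq_left ((one_le_div (by unfold proposalDensity; positivity)).2 ?_)
  unfold proposalDensity
  rw [det_fderiv_midpointMap_swap hJ hU x y]
  set A := Matrix.toEuclideanCLM (n := Fin d) (𝕜 := ℝ) J
  set z := (1 / 2 : ℝ) • (x + y) with hz
  set c := 1 / (4 * Real.pi * h) ^ ((d : ℝ) / 2) * |(fderiv ℝ (midpointMap U J h ξ x) y).det|
  have hc0 : 0 < c := mul_pos hc hd0
  -- Forward and backward residuals share the same displacement up to sign, so its square cancels in
  -- the ratio.
  have h1 : midpointMap U J h ξ x y - (x - h • gradient U x) =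
      (y - x + (h * sgn ξ) • A (gradient U z)) + h • gradient U x := by
    simp only [midpointMap, drift, ← hz]; abel
  have h2 : midpointMap U J h (-ξ) y x - (y - h • gradient U y) =
      -(y - x + (h * sgn ξ) • A (gradient U z)) + h • gradient U y := by
    simp only [midpointMap, drift, add_comm y x, ← hz, sgn_neg]; module
  rw [h1, h2, mul_left_comm, mul_left_comm (Real.exp (-U y)), ← Real.exp_add, ← Real.exp_add]
  refine mul_le_mul_of_nonneg_left (Real.exp_le_exp.2 ?_) hc0.le
  set v := y - x + (h * sgn ξ) • A (gradient U z) with hv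
  have h3 : ⟪v, gradient U x + gradient U y⟫ = ⟪y - x, gradient U x + gradient U y⟫ +
      h * sgn ξ * ⟪A (gradient U z), gradient U x + gradient U y⟫ := by
    rw [hv, inner_add_left, inner_smul_left]; rfl
  have h4 : ‖v + h • gradient U x‖ ^ 2 = ‖v‖ ^ 2 + 2 * (h * ⟪v, gradient U x⟫) +
      h ^ 2 * ‖gradient U x‖ ^ 2 := by
    rw [norm_add_sq_real, inner_smul_right, norm_smul, mul_pow, Real.norm_of_nonneg hh.le]
  have h5 : ‖-v + h • gradient U y‖ ^ 2 = ‖v‖ ^ 2 - 2 * (h * ⟪v, gradient U y⟫) +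
      h ^ 2 * ‖gradient U y‖ ^ 2 := by
    rw [norm_add_sq_real, inner_smul_right, norm_smul, mul_pow, Real.norm_of_nonneg hh.le,
      norm_neg, inner_neg_left]
    ring
  rw [inner_add_right] at h3
  rw [h4, h5]
  have h6 : ∀ a b c : ℝ, (a + 2 * (h * b) + h ^ 2 * c) / (4 * h) = a / (4 * h) + b / 2 + h * c / 4 := by
    intro a b c; field_simp; ring
  have h7 : ∀ a b c : ℝ, (a - 2 * (h * b) + h ^ 2 * c) / (4 * h) = a / (4 * h) - b / 2 + h * c / 4 := by
    intro a b c; field_simp; ring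
  rw [h6, h7]
  linarith

/-- The probability of rejecting a proposal. -/
noncomputable def rejectProb (U : Space d → ℝ) (J : Matrix (Fin d) (Fin d) ℝ) (h : ℝ) (ξ : ℤˣ)
    (x : Space d) : ℝ≥0∞ :=
  1 - ∫⁻ y, ENNReal.ofReal (acceptProb U J h ξ x y) ∂(proposal U J h ξ x)

theorem rejectProb_le_one (x : Space d) : rejectProb U J h ξ x ≤ 1 := tsub_le_self

theorem rejectProb_le_of_accept (hU : ControlledPotential U) (hh : 0 < h) {x : Space d}
    (hb : Function.Bijective (midpointMap U J h ξ x)) {r : ℝ}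
    (hacc : ∀ χ, ‖χ‖ ≤ r → acceptProb U J h ξ x (midpointMove U J h ξ x χ) = 1) :
    rejectProb U J h ξ x ≤ stdGaussian (Space d) {χ | r < ‖χ‖} := by
  have hm : MeasurableSet {χ : Space d | r < ‖χ‖} := measurableSet_lt measurable_const measurable_norm
  rw [rejectProb, proposal, (midpointMove_measurableEmbedding hU hh hb).lintegral_map,
    tsub_le_iff_left]
  have h1 : stdGaussian (Space d) {χ | r < ‖χ‖}ᶜ ≤ ∫⁻ χ, ENNReal.ofReal
      (acceptProb U J h ξ x (midpointMove U J h ξ x χ)) ∂(stdGaussian (Space d)) := by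
    rw [← lintegral_indicator_one hm.compl]
    refine lintegral_mono fun χ => ?_
    by_cases hχ : r < ‖χ‖
    · simp [hχ]
    · rw [hacc χ (not_lt.1 hχ)]
      rw [ENNReal.ofReal_one]
      exact Set.indicator_le_self' (fun _ _ => zero_le) χ
  calc (1 : ℝ≥0∞) = stdGaussian (Space d) Set.univ := measure_univ.symm
    _ = stdGaussian (Space d) {χ | r < ‖χ‖}ᶜ + stdGaussian (Space d) {χ | r < ‖χ‖} := by
        rw [add_comm, measure_add_measure_compl hm]
    _ ≤ _ := by gcongr

instance : MeasurableSingletonClass ℤˣ where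
  measurableSet_singleton u := by
    have : ({u} : Set ℤˣ) = Units.val ⁻¹' {(u : ℤ)} := by ext; simp [Units.ext_iff]
    rw [this]
    exact (comap_measurable Units.val) (measurableSet_singleton _)

/-- Bounding the acceptance probability by 1 loses nothing that matters, since the whole proposal
contracts `V_s`. Arbitrary `f` is allowed because the inner integral of `twoStep` is not shown to be
measurable. -/
theorem lintegral_transition_le (f : State d → ℝ≥0∞) (z : State d) :
    ∫⁻ w, f w ∂(transition U J h z) ≤
      ∫⁻ y, f (y, z.2) ∂(proposal U J h z.2 z.1) +
        rejectProb U J h z.2 z.1 * f (z.1, -z.2) := by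
  rw [transition, lintegral_add_measure, lintegral_smul_measure, lintegral_dirac, smul_eq_mul]
  gcongr
  · refine (lintegral_map_le _ _).trans (lintegral_mono' ?_ le_rfl)
    calc _ ≤ (proposal U J h z.2 z.1).withDensity 1 := withDensity_mono (ae_of_all _ fun y => by
          simp [acceptProb])
      _ = _ := withDensity_one
  · rfl

end Acceptance

/-! ### Drift of the Lyapunov function over one and two steps. -/

section Drift

open scoped RealInnerProductSpace

variable {d : ℕ} {U : Space d → ℝ} {J : Matrix (Fin d) (Fin d) ℝ} {h L : ℝ}

/-- The factor by which one proposal contracts the Lyapunov function on average. -/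
noncomputable def contractionFactor (U : Space d → ℝ) (s h : ℝ) (x : Space d) : ℝ≥0∞ :=
  ENNReal.ofReal (Real.exp (-(s * (h * ‖gradient U x‖ ^ 2 / 4)))) *
    ∫⁻ χ, ENNReal.ofReal (Real.exp (s * 10 * ‖χ‖ ^ 2)) ∂(stdGaussian (Space d))

/-- An accepted move may land where the gradient is small, so the second step needs a bound uniform
in the position. -/
theorem contractionFactor_le {s : ℝ} (hs : 0 ≤ s) (hh : 0 ≤ h) (x : Space d) :
    contractionFactor U s h x ≤
      ∫⁻ χ, ENNReal.ofReal (Real.exp (s * 10 * ‖χ‖ ^ 2)) ∂(stdGaussian (Space d)) := by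
  refine mul_le_of_le_one_left' ?_
  rw [ENNReal.ofReal_le_one, Real.exp_le_one_iff]
  have : 0 ≤ s * (h * ‖gradient U x‖ ^ 2 / 4) := by positivity
  linarith

theorem lintegral_lyapunov_proposal_le (hJ : Jᵀ = -J) (hU : ControlledPotential U)
    (hL0 : 0 ≤ L) (hL : ∀ x, ‖hessian U x‖ ≤ L) (hh : 0 < h)
    (hhL : h * ‖Matrix.toEuclideanCLM (n := Fin d) (𝕜 := ℝ) J‖ * L ≤ 1)
    (hh1 : h * ‖Matrix.toEuclideanCLM (n := Fin d) (𝕜 := ℝ) J‖ * L *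
      (‖Matrix.toEuclideanCLM (n := Fin d) (𝕜 := ℝ) J‖ + 1) ≤ 1 / 4)
    (hh2 : 8 * L * h * (‖Matrix.toEuclideanCLM (n := Fin d) (𝕜 := ℝ) J‖ + 1) ^ 2 ≤ 1 / 4)
    {s : ℝ} (hs : 0 ≤ s) (ξ η : ℤˣ) (x : Space d) :
    ∫⁻ y, lyapunov U s (y, η) ∂(proposal U J h ξ x) ≤
      contractionFactor U s h x * lyapunov U s (x, η) := by
  have hb := midpointMap_bijective (ξ := ξ) hU hL hh.le hhL x
  rw [proposal]
  refine (lintegral_map_le _ _).trans ?_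
  rw [contractionFactor, lyapunov, mul_right_comm, ← ENNReal.ofReal_mul (Real.exp_pos _).le,
    ← Real.exp_add, ← lintegral_const_mul _ (by fun_prop)]
  refine lintegral_mono fun χ => ?_
  rw [lyapunov, ← ENNReal.ofReal_mul (Real.exp_pos _).le, ← Real.exp_add]
  refine ENNReal.ofReal_le_ofReal (Real.exp_le_exp.2 ?_)
  have hstep := potential_midpoint_step_le hU.hasGradientAt hL0
    (hU.norm_gradient_sub_le hL) (inner_toEuclideanCLM_self_of_skew hJ) hh (abs_sgn ξ) hhL hh1 hh2
    (midpointMap_midpointMove hb χ)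
  have := mul_le_mul_of_nonneg_left hstep hs
  linarith

theorem tendsto_contractionFactor (hU : ControlledPotential U) {s : ℝ} (hs : 0 < s) (hh : 0 < h)
    (hfin : ∫⁻ χ, ENNReal.ofReal (Real.exp (s * 10 * ‖χ‖ ^ 2)) ∂(stdGaussian (Space d)) ≠ ∞) :
    Tendsto (contractionFactor U s h) (Bornology.cobounded (Space d)) (𝓝 0) := by
  have h1 : Tendsto (fun x : Space d => s * (h * ‖gradient U x‖ ^ 2 / 4))
      (Bornology.cobounded (Space d)) atTop := by
    refine Tendsto.const_mul_atTop hs (Tendsto.atTop_div_const (by norm_num)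
      (Tendsto.const_mul_atTop hh ?_))
    exact (tendsto_pow_atTop two_ne_zero).comp hU.tendsto_norm_gradient
  have h2 := ENNReal.tendsto_ofReal
    (Real.tendsto_exp_atBot.comp (tendsto_neg_atTop_atBot.comp h1))
  rw [ENNReal.ofReal_zero] at h2
  have h3 := ENNReal.Tendsto.mul_const (b := ∫⁻ χ, ENNReal.ofReal (Real.exp (s * 10 * ‖χ‖ ^ 2))
    ∂(stdGaussian (Space d))) h2 (Or.inr hfin)
  rw [zero_mul] at h3
  exact h3

theorem tendsto_stdGaussian_norm_gt (d : ℕ) :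
    Tendsto (fun r : ℝ => stdGaussian (Space d) {χ | r < ‖χ‖}) atTop (𝓝 0) := by
  simpa using tendsto_measure_norm_gt_of_isTightMeasureSet
    (isTightMeasureSet_singleton (μ := stdGaussian (Space d)))

/-- Two step drift estimate, given bounds for one step and for the rejection probabilities. -/
theorem twoStep_lyapunov_le {s : ℝ} {e : Space d → ℝ≥0∞} {D τ : ℝ≥0∞}
    (he : ∀ ξ η x, ∫⁻ y, lyapunov U s (y, η) ∂(proposal U J h ξ x) ≤ e x * lyapunov U s (x, η))
    (heD : ∀ x, e x ≤ D) {x : Space d} {ξ : ℤˣ}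
    (hτ : rejectProb U J h ξ x ≤ τ ∨ rejectProb U J h (-ξ) x ≤ τ)
    (hV : Measurable (fun y => lyapunov U s (y, ξ))) :
    twoStep U J h (lyapunov U s) (x, ξ) ≤
      ((D + 1) * e x + (e x + τ)) * lyapunov U s (x, ξ) := by
  have hone : ∀ (y : Space d) (η : ℤˣ), ∫⁻ v, lyapunov U s v ∂(transition U J h (y, η)) ≤
      (e y + rejectProb U J h η y) * lyapunov U s (y, η) := by
    intro y η
    refine (lintegral_transition_le _ _).trans ?_
    rw [add_mul]
    exact add_le_add (he η η y) le_rfl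
  refine (lintegral_transition_le _ _).trans ?_
  rw [add_mul]
  refine add_le_add ?_ ?_
  · calc _ ≤ ∫⁻ y, (D + 1) * lyapunov U s (y, ξ) ∂(proposal U J h ξ x) := by
          refine lintegral_mono fun y => (hone y ξ).trans ?_
          gcongr
          · exact heD y
          · exact rejectProb_le_one y
      _ = (D + 1) * ∫⁻ y, lyapunov U s (y, ξ) ∂(proposal U J h ξ x) := lintegral_const_mul _ hV
      _ ≤ (D + 1) * (e x * lyapunov U s (x, ξ)) := by gcongr; exact he ξ ξ x
      _ = _ := (mul_assoc _ _ _).symm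
  -- After a rejection the position is unchanged and `lyapunov` ignores the direction; a double
  -- rejection carries the product of both probabilities, so one small factor suffices.
  · calc _ ≤ rejectProb U J h ξ x * ((e x + rejectProb U J h (-ξ) x) * lyapunov U s (x, -ξ)) := by
          gcongr; exact hone x (-ξ)
      _ = (rejectProb U J h ξ x * (e x + rejectProb U J h (-ξ) x)) * lyapunov U s (x, ξ) := by
          rw [mul_assoc]; rfl
      _ ≤ _ := by
          gcongr
          rw [mul_add]
          refine add_le_add (mul_le_of_le_one_left' (rejectProb_le_one x)) ?_
          rcases hτ with hτ | hτ
          · exact (mul_le_of_le_one_right' (rejectProb_le_one x)).trans hτ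
          · exact (mul_le_of_le_one_left' (rejectProb_le_one x)).trans hτ

/-- Far away, one of the two directions is accepted with high probability. -/
theorem eventually_rejectProb_le (hJ : Jᵀ = -J) (hU : ControlledPotential U) {K m : ℝ}
    (hL1 : 1 ≤ L) (hL : ∀ x, ‖hessian U x‖ ≤ L) (hh : 0 < h) (hle : h ≤ 1)
    (hhL : h * ‖Matrix.toEuclideanCLM (n := Fin d) (𝕜 := ℝ) J‖ * L ≤ 1)
    (hhB : (2 * ‖Matrix.toEuclideanCLM (n := Fin d) (𝕜 := ℝ) J‖ + 4) * h * L ≤ 1 / 4)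
    (hsmall : h * acceptConst ‖Matrix.toEuclideanCLM (n := Fin d) (𝕜 := ℝ) J‖ L K ≤ m / 2)
    (hm : ∀ᶠ x in Bornology.cobounded (Space d), ∀ v, m * ‖v‖ ^ 2 ≤ ⟪v, hessian U x v⟫)
    (hK : ∀ᶠ x in Bornology.cobounded (Space d), ∀ a : ℝ, 0 ≤ a → a * L ≤ 1 / 4 →
      ∃ Λ : ℝ, 0 ≤ Λ ∧ Λ * ‖gradient U x‖ ≤ K ∧
        ∀ p ∈ Metric.closedBall x (a * ‖gradient U x‖),
          ∀ q ∈ Metric.closedBall x (a * ‖gradient U x‖),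
            ‖hessian U p - hessian U q‖ ≤ Λ * ‖p - q‖) (ξ : ℤˣ) :
    ∀ᶠ x in Bornology.cobounded (Space d),
      rejectProb U J h ξ x ≤
          stdGaussian (Space d) {χ | h ^ 2 / √(2 * h) * ‖gradient U x‖ < ‖χ‖} ∨
        rejectProb U J h (-ξ) x ≤
          stdGaussian (Space d) {χ | h ^ 2 / √(2 * h) * ‖gradient U x‖ < ‖χ‖} := by
  filter_upwards [hm, hK] with x hmx hKx
  set A := Matrix.toEuclideanCLM (n := Fin d) (𝕜 := ℝ) J with hA
  have hs0 : 0 < √(2 * h) := by positivity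
  have key : ∀ η : ℤˣ, 0 ≤ sgn η * ⟪gradient U x, hessian U x (A (gradient U x))⟫ →
      rejectProb U J h η x ≤
        stdGaussian (Space d) {χ | h ^ 2 / √(2 * h) * ‖gradient U x‖ < ‖χ‖} := by
    intro η hη
    have hb := midpointMap_bijective (ξ := η) hU hL hh.le hhL x
    refine rejectProb_le_of_accept hU hh hb fun χ hχ => ?_
    refine acceptProb_eq_one hJ hU hL hh hhL ?_
    obtain ⟨Λ, hΛ0, hΛK, hΛ⟩ := hKx ((2 * ‖A‖ + 4) * h) (by positivity) hhB
    refine log_accept_ratio_nonneg hU.hasGradientAt hU.hasFDerivAt_gradient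
      hU.inner_hessian_comm (by linarith) (hU.norm_gradient_sub_le hL) (hL x)
      (inner_toEuclideanCLM_self_of_skew hJ) hh hle (abs_sgn η) hhL hΛ0 hΛK hΛ (hmx _) hη
      hsmall ?_ (midpointMap_midpointMove hb χ)
    rw [norm_smul, Real.norm_of_nonneg hs0.le]
    calc √(2 * h) * ‖χ‖ ≤ √(2 * h) * (h ^ 2 / √(2 * h) * ‖gradient U x‖) := by gcongr
      _ = _ := by field_simp
  -- The favourable direction depends on `x`, hence a disjunction at each point.
  by_cases h0 : 0 ≤ sgn ξ * ⟪gradient U x, hessian U x (A (gradient U x))⟫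
  · exact Or.inl (key ξ h0)
  · refine Or.inr (key (-ξ) ?_)
    rw [sgn_neg]
    linarith

end Drift

end GMALA

/-! ### Choice of constants and conclusion. -/

theorem proposition2p6 {d : ℕ} (U : GMALA.Space d → ℝ) (J : Matrix (Fin d) (Fin d) ℝ)
    (hJ : Jᵀ = -J) (hU : GMALA.ControlledPotential U) :
    ∃ s : ℝ, 0 < s ∧ ∃ h₀ : ℝ, 0 < h₀ ∧ ∀ h : ℝ, 0 < h → h ≤ h₀ → ∀ ξ : ℤˣ,
      (∀ x χ : GMALA.Space d, ∃! y : GMALA.Space d, GMALA.IsMidpointMove U J h ξ x χ y) ∧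
      (∀ x : GMALA.Space d, GMALA.proposal U J h ξ x =
        volume.withDensity (fun y => ENNReal.ofReal (GMALA.proposalDensity U J h ξ x y))) ∧
      Tendsto
        (fun x : GMALA.Space d =>
          GMALA.twoStep U J h (GMALA.lyapunov U s) (x, ξ) / GMALA.lyapunov U s (x, ξ))
        (Bornology.cobounded (GMALA.Space d)) (𝓝 0) := by
  obtain ⟨m, M, R, hm, hR, hmR⟩ := hU.exists_hessian_lower
  obtain ⟨L, hL1, hL⟩ := hU.exists_norm_hessian_le
  obtain ⟨K, hK0, hK⟩ := hU.exists_hessian_lipschitz hL1 hL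
  -- Fernique's theorem; `s = C / 10` offsets the factor 10 of the noise term and does not depend on
  -- `h`.
  obtain ⟨C, hC, hCint⟩ := IsGaussian.exists_integrable_exp_sq (stdGaussian (GMALA.Space d))
  set j := ‖Matrix.toEuclideanCLM (n := Fin d) (𝕜 := ℝ) J‖ with hj
  have hj0 : 0 ≤ j := norm_nonneg _
  set b := |GMALA.acceptConst j L K| / (2 * m) with hb
  have hb0 : 0 ≤ b := by positivity
  -- Each smallness condition on `h` corresponds to a nonnegative summand, so `h * c ≤ 1 / 4` yields
  -- them all; `b` is scaled to give `hsmall`.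
  set c := 1 + j * L * (j + 1) + 8 * L * (j + 1) ^ 2 + (2 * j + 4) * L + b with hc
  have hc0 : 0 < c := by positivity
  refine ⟨C / 10, by positivity, 1 / (4 * c), by positivity, fun h hh hle ξ => ?_⟩
  have hhc : h * c ≤ 1 / 4 := by
    calc h * c ≤ 1 / (4 * c) * c := by gcongr
      _ = 1 / 4 := by field_simp
  have e1 : 0 ≤ h * (j * L * (j + 1)) := by positivity
  have e2 : 0 ≤ h * (8 * L * (j + 1) ^ 2) := by positivity
  have e3 : 0 ≤ h * ((2 * j + 4) * L) := by positivity
  have e4 : 0 ≤ h * b := by positivity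
  have e5 : 0 ≤ h * j * L := by positivity
  have e6 : 0 ≤ h * j * L * j := by positivity
  rw [hc] at hhc
  have hhL : h * j * L ≤ 1 := by linarith
  have hsmall : h * GMALA.acceptConst j L K ≤ m / 2 := by
    have e7 : h * b ≤ 1 / 4 := by linarith
    have e8 : h * |GMALA.acceptConst j L K| = h * b * (2 * m) := by rw [hb]; field_simp
    have e9 := mul_le_mul_of_nonneg_left (le_abs_self (GMALA.acceptConst j L K)) hh.le
    have e10 := mul_le_mul_of_nonneg_right e7 (show 0 ≤ 2 * m by positivity)
    linarith
  have hbij : ∀ x, Function.Bijective (GMALA.midpointMap U J h ξ x) :=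
    GMALA.midpointMap_bijective hU hL hh.le hhL
  refine ⟨fun x χ => (hbij x).existsUnique _,
    fun x => GMALA.proposal_eq_withDensity hU hh (hbij x), ?_⟩
  have hfin : ∫⁻ χ, ENNReal.ofReal (Real.exp (C / 10 * 10 * ‖χ‖ ^ 2))
      ∂(stdGaussian (GMALA.Space d)) ≠ ∞ := by
    rw [div_mul_cancel₀ _ (by norm_num : (10 : ℝ) ≠ 0)]
    exact hCint.lintegral_lt_top.ne
  set D := ∫⁻ χ, ENNReal.ofReal (Real.exp (C / 10 * 10 * ‖χ‖ ^ 2))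
      ∂(stdGaussian (GMALA.Space d)) with hD
  have hs : 0 < C / 10 := by positivity
  have hrej := GMALA.eventually_rejectProb_le hJ hU hL1 hL hh (by linarith) hhL (by linarith)
    hsmall ((tendsto_norm_cobounded_atTop.eventually (eventually_gt_atTop R)).mono
      fun x hx => (hmR x hx).1) hK ξ
  have hV : Measurable (fun y => GMALA.lyapunov U (C / 10) (y, ξ)) := by
    have := hU.differentiable_one.continuous.measurable
    unfold GMALA.lyapunov
    fun_prop
  have htail : Tendsto (fun x => stdGaussian (GMALA.Space d)
      {χ | h ^ 2 / √(2 * h) * ‖gradient U x‖ < ‖χ‖}) (Bornology.cobounded (GMALA.Space d)) (𝓝 0) :=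
    (GMALA.tendsto_stdGaussian_norm_gt d).comp
      (Tendsto.const_mul_atTop (by positivity) hU.tendsto_norm_gradient)
  have he := GMALA.tendsto_contractionFactor hU hs hh hfin
  have hlim := (ENNReal.Tendsto.const_mul (a := D + 1) he
    (Or.inr (ENNReal.add_ne_top.2 ⟨hfin, ENNReal.one_ne_top⟩))).add (he.add htail)
  simp only [mul_zero, add_zero] at hlim
  refine tendsto_of_tendsto_of_tendsto_of_le_of_le' tendsto_const_nhds hlim
    (Eventually.of_forall fun _ => zero_le) ?_
  filter_upwards [hrej] with x hx
  refine ENNReal.div_le_of_le_mul ?_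
  exact GMALA.twoStep_lyapunov_le
    (fun ξ η x => GMALA.lintegral_lyapunov_proposal_le hJ hU (by linarith) hL hh hhL (by linarith)
      (by linarith) hs.le ξ η x)
    (fun x => GMALA.contractionFactor_le hs.le hh.le x) hx hV
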